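/- Let $\mathcal M$ be a model category (with all small limits and colimits) in which all projections are fibrations, that is, for every set $I$, every subset $K\subseteq I$ and every family $(x_i)_{i\in I}$ of objects, the canonical map $\prod_{i\in I}x_i\to\prod_{i\in K}x_i$ is a fibration. Let $G$ be a finite graph with vertex set $V$ and edge set $E$; loops and multiple edges are allowed. Let $Q=Q(G)$ be the quiver with vertex set $V\sqcup E$ and with one arrow $v\to e$ for each non-loop edge $e$ and each end $v$ of $e$, and two arrows $v\to e$ for each loop $e$ at $v$. Let $F(Q)$ be the free category on $Q$ and let $X\colon F(Q)\to\mathcal M$ be a diagram. A Reedy structure on a small category $J$ is a pair $(J^+,J^-)$ of wide subcategories for which there exists a degree function $\mathrm{ob}\,J\to\mathbb N$ that is raised by the non-identity morphisms of $J^+$ and lowered by those of $J^-$, and such that every morphism factors uniquely as a morphism of $J^-$ followed by a morphism of $J^+$. It has cofibrant constants if for each object $\alpha$ the latching category $\partial(J^+/\alpha)$ (the slice category $J^+/\alpha$ without $\mathrm{id}_\alpha$) is connected or empty. In the induced Reedy model structure on $\mathcal M^J$ the weak equivalences are the objectwise ones, and $X\to Y$ is a fibration if for each $\alpha$ the map $X_\alpha\to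 Y_\alpha\times_{M_\alpha Y}M_\alpha X$ is a fibration in $\mathcal M$, where $M_\alpha X=\lim_{(\alpha\to\beta)\in\partial(\alpha/J^-)}X_\beta$. Let $G^{\mathrm s}$ be the graph obtained from $G$ by removing all loops. For an orientation $\mathfrak o$ of $G^{\mathrm s}$ and a vertex $v\in V$, let $A_{\mathfrak o}(v)$ be the set of arrows $v\to e$ of $Q$ such that $e$ is a loop at $v$ or an edge of $G^{\mathrm s}$ whose $\mathfrak o$-target is $v$, and let $$\varphi^X_{\mathfrak o}(v)\colon X^v\longrightarrow\prod_{(x\colon v\to e)\in A_{\mathfrak o}(v)}X^{e}$$ be the map with components $X(x)$. Then the following are equivalent: 1. there is a Reedy structure on $F(Q)$ with cofibrant constants such that $X$ is fibrant in the induced Reedy model structure on $\mathcal M^{F(Q)}$; 2. there is an acyclic orientation $\mathfrak o$ of $G^{\mathrm s}$ such that $\varphi^X_{\mathfrak o}(v)$ is a fibration for every vertex $v\in V$. Moreover, the homotopy limit functor $\operatorname{holim}\colon\mathrm{Ho}(\mathcal M^{F(Q)})\to\mathrm{Ho}(\mathcal M)$ (the total right derived functor of $\lim$ with respect to the objectwise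 weak equivalences) exists, and if the equivalent conditions 1 and 2 hold, then $\operatorname{holim}X\simeq\lim X$: the canonical map $\lim X\to\operatorname{holim}X$ is an isomorphism in $\mathrm{Ho}(\mathcal M)$. -/

import Mathlib

open CategoryTheory CategoryTheory.Limits HomotopicalAlgebra

universe w v u

namespace GraphicReedy

noncomputable section

/-! ### Reedy structures and Reedy fibrations -/

/-- A Reedy structure on `J`: a pair `(J⁻, J⁺)` of wide subcategories for which there exists a degree
function `ob J → ℕ` lowered by the non-identity morphisms of `J⁻` and raised by those of `J⁺`, and
such that each morphism factors uniquely as a morphism of `J⁻` followed by one of `J⁺`.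
The degree function is not part of the data. -/
structure ReedyPair (J : Type w) [SmallCategory J] where
  /-- the morphisms of `J⁻` -/
  minus : MorphismProperty J
  /-- the morphisms of `J⁺` -/
  plus : MorphismProperty J
  minus_mul : minus.IsMultiplicative
  plus_mul : plus.IsMultiplicative
  exists_deg : Nonempty (ReedyStructure minus plus ℕ)

namespace ReedyPair

attribute [instance] minus_mul plus_mul

variable {J : Type w} [SmallCategory J] (R : ReedyPair J)

/-- The objects of the slice `J⁺/α` of the category `J⁺` other than `id_α`. -/
def latchingProp (α : J) : ObjectProperty (R.plus.Over R.plus α) :=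
  fun f => ¬ MorphismProperty.identities J f.hom

/-- The objects of the coslice `α/J⁻` of the category `J⁻` other than `id_α`. -/
def matchingProp (α : J) : ObjectProperty (R.minus.Under R.minus α) :=
  fun f => ¬ MorphismProperty.identities J f.hom

/-- The latching category `∂(J⁺/α)`. -/
abbrev Latching (α : J) : Type w := (R.latchingProp α).FullSubcategory

/-- The matching category `∂(α/J⁻)`. -/
abbrev Matching (α : J) : Type w := (R.matchingProp α).FullSubcategory

/-- Each latching category has at most one connected component (it is connected or empty). -/
def CofibrantConstants : Prop :=
  ∀ α : J, IsPreconnected (R.Latching α)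

/-- The functor `∂(α/J⁻) ⥤ J`, `(α ⟶ β) ↦ β`. -/
abbrev matchingForget (α : J) : R.Matching α ⥤ J :=
  (R.matchingProp α).ι ⋙ MorphismProperty.Under.forget R.minus R.minus α ⋙
    CategoryTheory.Under.forget α

/-- The morphism `f : α ⟶ β` underlying an object of `∂(α/J⁻)`. -/
def matchingHom {α : J} (f : R.Matching α) : α ⟶ (R.matchingForget α).obj f :=
  f.obj.hom

/-- The cone with vertex `α` over `matchingForget`, whose leg at `f : α ⟶ β` is `f`. -/
@[simps]
def matchingCone (α : J) : Cone (R.matchingForget α) where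
  pt := α
  π :=
    { app := fun f => R.matchingHom f
      naturality := fun f g φ => by
        exact (Category.id_comp _).trans (MorphismProperty.Under.w φ.hom).symm }

variable {M : Type u} [Category.{v} M] [HasLimitsOfSize.{w, w} M]

/-- The matching object `M_α X = lim_{(α ⟶ β) ∈ ∂(α/J⁻)} X_β`. -/
abbrev matchingObj (X : J ⥤ M) (α : J) : M :=
  limit (R.matchingForget α ⋙ X)

/-- The matching map `X_α ⟶ M_α X`. -/
def matchingMap (X : J ⥤ M) (α : J) : X.obj α ⟶ R.matchingObj X α :=
  limit.lift (R.matchingForget α ⋙ X) (X.mapCone (R.matchingCone α))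

lemma matchingMap_π (X : J ⥤ M) (α : J) (j : R.Matching α) :
    R.matchingMap X α ≫ limit.π (R.matchingForget α ⋙ X) j = X.map (R.matchingHom j) :=
  limit.lift_π _ _

/-- The map `M_α X ⟶ M_α Y` induced by `f : X ⟶ Y`. -/
def matchingObjMap {X Y : J ⥤ M} (f : X ⟶ Y) (α : J) :
    R.matchingObj X α ⟶ R.matchingObj Y α :=
  limMap (Functor.whiskerLeft (R.matchingForget α) f)

lemma matchingObjMap_π {X Y : J ⥤ M} (f : X ⟶ Y) (α : J) (j : R.Matching α) :
    R.matchingObjMap f α ≫ limit.π (R.matchingForget α ⋙ Y) j =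
      limit.π (R.matchingForget α ⋙ X) j ≫ f.app ((R.matchingForget α).obj j) :=
  limMap_π _ _

lemma matching_comm {X Y : J ⥤ M} (f : X ⟶ Y) (α : J) :
    f.app α ≫ R.matchingMap Y α = R.matchingMap X α ≫ R.matchingObjMap f α := by
  apply limit.hom_ext
  intro j
  rw [Category.assoc, Category.assoc, matchingMap_π, matchingObjMap_π, ← Category.assoc (R.matchingMap X α),
    matchingMap_π]
  exact (f.naturality _).symm

variable [ModelCategory M]

/-- The relative matching map `X_α ⟶ Y_α ×_{M_α Y} M_α X` of `f : X ⟶ Y`. -/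
abbrev relMatchingMap {X Y : J ⥤ M} (f : X ⟶ Y) (α : J) :
    X.obj α ⟶ pullback (R.matchingMap Y α) (R.matchingObjMap f α) :=
  pullback.lift (f.app α) (R.matchingMap X α) (R.matching_comm f α)

variable (M) in
/-- The fibrations of the Reedy model structure on `J ⥤ M` induced by `R`: the maps all of whose
relative matching maps are fibrations in `M`. -/
@[reducible]
def reedyFibrations : CategoryWithFibrations (J ⥤ M) where
  fibrations := fun _ _ f => ∀ α : J, Fibration (R.relMatchingMap f α)

/-- `X` is a fibrant object of the Reedy model structure on `J ⥤ M` induced by `R`: the map from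
`X` to the terminal diagram is a Reedy fibration. -/
def IsReedyFibrant (X : J ⥤ M) : Prop :=
  letI := R.reedyFibrations M
  IsFibrant X

end ReedyPair

/-! ### Homotopy limits -/

section Holim

variable (J : Type w) [SmallCategory J] (M : Type u) [Category.{v} M] [HasLimitsOfSize.{w, w} M]
  [ModelCategory M]

/-- The objectwise weak equivalences of diagrams. -/
abbrev objectwiseWeakEquivalences : MorphismProperty (J ⥤ M) :=
  (weakEquivalences M).functorCategory J

/-- The limit functor, followed by the localization functor `M ⥤ Ho(M)`. -/
abbrev limHo : (J ⥤ M) ⥤ (weakEquivalences M).Localization :=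
  lim ⋙ (weakEquivalences M).Q

/-- The homotopy limit functor exists: the limit functor has a total right derived functor. -/
abbrev HasHolim : Prop :=
  (limHo J M).HasRightDerivedFunctor (objectwiseWeakEquivalences J M)

/-- The homotopy limit functor `Ho(M^J) ⥤ Ho(M)`: the total right derived functor of `lim`. -/
def holim [HasHolim J M] :
    (objectwiseWeakEquivalences J M).Localization ⥤ (weakEquivalences M).Localization :=
  (limHo J M).totalRightDerived (objectwiseWeakEquivalences J M).Q (objectwiseWeakEquivalences J M)

variable {J M} in
/-- The canonical map `lim X ⟶ holim X` in `Ho(M)`. -/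
def limToHolim [HasHolim J M] (X : J ⥤ M) :
    (weakEquivalences M).Q.obj (limit X) ⟶
      (holim J M).obj ((objectwiseWeakEquivalences J M).Q.obj X) :=
  ((limHo J M).totalRightDerivedUnit (objectwiseWeakEquivalences J M).Q
    (objectwiseWeakEquivalences J M)).app X

end Holim

/-- Every projection `∏_{i ∈ I} x_i ⟶ ∏_{i ∈ K} x_i`, for `I` a set and `K ⊆ I`, is a fibration. -/
def ProjectionsAreFibrations (M : Type u) [Category.{v} M] [HasLimitsOfSize.{w, w} M]
    [ModelCategory M] : Prop :=
  ∀ (I : Type w) (K : Set I) (x : I → M),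
    Fibration (Pi.lift (fun k : K => Pi.π x k) : ∏ᶜ x ⟶ ∏ᶜ (fun k : K => x k))

/-! ### Graphs and graphic quivers -/

section Graphs

variable {V E : Type w}

/-- The vertices of the quiver `Q(G)`: the disjoint union of the vertices and the edges of `G`. -/
inductive GraphicQuiver (G : Graph V E) : Type w
  | vertex (v : G.vertexSet) : GraphicQuiver G
  | edge (e : G.edgeSet) : GraphicQuiver G

/-- The arrows `v ⟶ e` of `Q(G)`: two if `e` is a loop at `v`, one if `e` is a non-loop edge incident
to `v`, none otherwise. -/
def HalfEdge (G : Graph V E) (v : G.vertexSet) (e : G.edgeSet) : Type :=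
  { i : Fin 2 // G.IsLoopAt e v ∨ (G.IsNonloopAt e v ∧ i = 0) }

instance (G : Graph V E) : Quiver.{0} (GraphicQuiver G) where
  Hom x y :=
    match x, y with
    | .vertex v, .edge e => HalfEdge G v e
    | _, _ => Empty

/-- The free category on `Q(G)`. -/
abbrev FreeCat (G : Graph V E) : Type w := Paths (GraphicQuiver G)

/-- A vertex of `G`, as an object of the free category on `Q(G)`. -/
abbrev vertexObj {G : Graph V E} (v : G.vertexSet) : FreeCat G :=
  (Paths.of (GraphicQuiver G)).obj (.vertex v)

/-- An edge of `G`, as an object of the free category on `Q(G)`. -/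
abbrev edgeObj {G : Graph V E} (e : G.edgeSet) : FreeCat G :=
  (Paths.of (GraphicQuiver G)).obj (.edge e)

/-- An arrow of `Q(G)`, as a morphism of the free category on `Q(G)`. -/
abbrev HalfEdge.hom {G : Graph V E} {v : G.vertexSet} {e : G.edgeSet} (x : HalfEdge G v e) :
    vertexObj v ⟶ edgeObj e :=
  (Paths.of (GraphicQuiver G)).map (X := .vertex v) (Y := .edge e) x

/-- The simplification `Gˢ`: the graph obtained by removing all loops. -/
def simplification (G : Graph V E) : Graph V E :=
  G.deleteEdges { e | ∃ v, G.IsLoopAt e v }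

/-- An orientation of a graph: a choice, for each edge, of which end is its source and which end
is its target. -/
structure Orientation (H : Graph V E) where
  source : H.edgeSet → V
  target : H.edgeSet → V
  isLink (e : H.edgeSet) : H.IsLink e (source e) (target e)

/-- There is no directed cycle. -/
def Orientation.Acyclic {H : Graph V E} (o : Orientation H) : Prop :=
  ∀ v : V, ¬ Relation.TransGen (fun a b => ∃ e, o.source e = a ∧ o.target e = b) v v

/-- The set `A_o(v)` of the arrows `v ⟶ e` of `Q(G)` for which `e` is either a loop at `v` or an edge
of `Gˢ` whose target under `o` is `v`. -/
def ArrowSet {G : Graph V E} (o : Orientation (simplification G)) (v : G.vertexSet) : Type w :=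
  { x : Σ e : G.edgeSet, HalfEdge G v e //
    G.IsLoopAt x.1 v ∨ ∃ h : (x.1 : E) ∈ (simplification G).edgeSet, o.target ⟨x.1, h⟩ = v }

/-- The map `φ_o^X(v) : X^v ⟶ ∏_{x ∈ A_o(v)} X^{c(x)}` with components `X(x)`, where `c(x)` is the
target of the arrow `x`. -/
def vertexMap {M : Type u} [Category.{v} M] [HasLimitsOfSize.{w, w} M] {G : Graph V E}
    (o : Orientation (simplification G)) (X : FreeCat G ⥤ M) (v : G.vertexSet) :
    X.obj (vertexObj v) ⟶ ∏ᶜ (fun x : ArrowSet o v => X.obj (edgeObj x.1.1)) :=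
  Pi.lift (fun x : ArrowSet o v => X.map x.1.2.hom)

end Graphs

end

end GraphicReedy

/-! All non-identity morphisms of the free category are single arrows from a vertex to an edge, so
no morphism factors non-trivially. A Reedy structure therefore sorts the arrows into `J⁺` and `J⁻`.
The matching category of a vertex is the discrete set of its `J⁻`-arrows, that of an edge is empty,
and the latching category of an edge is the discrete set of `J⁺`-arrows into it. Cofibrant constants
thus means: at most one `J⁺`-arrow into each edge. Projections with `K = ∅` make every object
fibrant, so Reedy fibrancy only says that each map from `X^v` to the product over its `J⁻`-arrows is
a fibration.

Degrees at the vertices, with ties broken, orient the non-loop edges so that `A_o(v)` consists of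
`J⁻`-arrows (`exists_orientation`). Conversely, an acyclic orientation of a finite graph has a rank
function, and this yields a degree function whose `J⁻`-arrows at `v` lie in `A_o(v)`
(`exists_reedyPair`). These inclusions suffice: since edge values are fibrant, the fibration
condition passes to smaller sets of arrows (`ObjLift.of_le`).

For homotopy limits no Reedy model structure is constructed. The injective model structure
(objectwise cofibrations and weak equivalences) makes `lim` right derivable, for any `X`. Injective
resolutions are also fibrant for the orientation, so it remains to see that `lim` preserves weak
equivalences between orientation-fibrant diagrams. This is a Ken Brown argument; its input is
`rlp_lim_map`, where lifts into a limit are built vertex by vertex along the orientation. -/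

namespace GraphicReedy

noncomputable section

/-! ### Diagrams on the free category of a graphic quiver -/

section FreeCat

variable {V E : Type w} {G : Graph V E}

/-- The arrows of `Q(G)` with source `v`. -/
abbrev Out (v : G.vertexSet) : Type w := Σ e : G.edgeSet, HalfEdge G v e

/-- A morphism of the free category is either an identity or an arrow of the quiver. -/
theorem FreeCat.hom_cases {P : ∀ {x y : FreeCat G}, (x ⟶ y) → Prop} (id : ∀ x, P (𝟙 x))
    (hom : ∀ {v : G.vertexSet} {e : G.edgeSet} (x : HalfEdge G v e), P x.hom)
    {x y : FreeCat G} (f : x ⟶ y) : P f := by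
  change Quiver.Path _ _ at f
  cases f with
  | nil => exact id _
  | @cons z _ p q =>
    match z, y, q with
    | .vertex v, .edge e, q =>
      cases p with
      | nil => exact hom q
      | @cons z' _ p' q' =>
        match z', q' with
        | .vertex _, q' => exact Empty.elim q'
        | .edge _, q' => exact Empty.elim q'
    | .vertex _, .vertex _, q => exact Empty.elim q
    | .edge _, .vertex _, q => exact Empty.elim q
    | .edge _, .edge _, q => exact Empty.elim q

theorem FreeCat.obj_cases {P : FreeCat G → Prop} (vertex : ∀ v : G.vertexSet, P (vertexObj v))
    (edge : ∀ e : G.edgeSet, P (edgeObj e)) (x : FreeCat G) : P x := by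
  cases x with
  | vertex v => exact vertex v
  | edge e => exact edge e

theorem HalfEdge.hom_injective {v : G.vertexSet} {e : G.edgeSet} :
    Function.Injective (HalfEdge.hom : HalfEdge G v e → (vertexObj v ⟶ edgeObj e)) := by
  intro x y h
  have h' : (Quiver.Path.nil.cons x : Quiver.Path (GraphicQuiver.vertex v) (.edge e)) =
    Quiver.Path.nil.cons y := h
  simpa using h'

theorem FreeCat.hom_vertex_edge {v : G.vertexSet} {e : G.edgeSet} (f : vertexObj v ⟶ edgeObj e) :
    ∃ x : HalfEdge G v e, f = x.hom := by
  change Quiver.Path _ _ at f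
  cases f with
  | @cons z _ p q =>
    match z, q with
    | .vertex v, q =>
      cases p with
      | nil => exact ⟨q, rfl⟩
      | @cons z' _ p' q' =>
        match z', q' with
        | .vertex _, q' => exact Empty.elim q'
        | .edge _, q' => exact Empty.elim q'
    | .edge _, q => exact Empty.elim q

theorem FreeCat.identities_of_target_vertex {x : FreeCat G} {v : G.vertexSet}
    (f : x ⟶ vertexObj v) : MorphismProperty.identities _ f := by
  change Quiver.Path _ _ at f
  cases f with
  | nil => exact .mk _
  | @cons z _ p q =>
    match z, q with
    | .vertex _, q => exact Empty.elim q
    | .edge _, q => exact Empty.elim q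

theorem FreeCat.identities_of_source_edge {e : G.edgeSet} {y : FreeCat G}
    (f : edgeObj e ⟶ y) : MorphismProperty.identities _ f := by
  generalize h : edgeObj e = x at f
  induction f using FreeCat.hom_cases with
  | id => exact .mk _
  | hom => cases h

variable {M : Type u} [Category.{v} M]

/-- The diagram with prescribed values on the vertices, the edges, and the arrows of `Q(G)`. -/
def mkDiagram (F : G.vertexSet → M) (F' : G.edgeSet → M)
    (a : ∀ (v : G.vertexSet) (x : Out v), F v ⟶ F' x.1) : FreeCat G ⥤ M :=
  Paths.lift
    { obj := fun x => match x with
        | .vertex v => F v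
        | .edge e => F' e
      map := fun {x y} f => match x, y, f with
        | .vertex v, .edge e, f => a v ⟨e, f⟩
        | .vertex _, .vertex _, f => Empty.elim f
        | .edge _, .vertex _, f => Empty.elim f
        | .edge _, .edge _, f => Empty.elim f }

theorem mkDiagram_map_hom (F : G.vertexSet → M) (F' : G.edgeSet → M)
    (a : ∀ (v : G.vertexSet) (x : Out v), F v ⟶ F' x.1) {v : G.vertexSet} (x : Out v) :
    (mkDiagram F F' a).map x.2.hom = a v x :=
  Paths.lift_toPath _ _

/-- A natural transformation of diagrams is determined by components which are compatible with the
arrows of `Q(G)`. -/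
def natTransMk {X Y : FreeCat G ⥤ M} (f : ∀ v : G.vertexSet, X.obj (vertexObj v) ⟶ Y.obj (vertexObj v))
    (f' : ∀ e : G.edgeSet, X.obj (edgeObj e) ⟶ Y.obj (edgeObj e))
    (h : ∀ (v : G.vertexSet) (x : Out v), X.map x.2.hom ≫ f' x.1 = f v ≫ Y.map x.2.hom) :
    X ⟶ Y where
  app x := match x with
    | .vertex v => f v
    | .edge e => f' e
  naturality x y g := by
    induction g using FreeCat.hom_cases with
    | id x =>
      rw [X.map_id, Y.map_id, Category.id_comp, Category.comp_id]
    | hom x => exact h _ ⟨_, x⟩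

theorem natTrans_ext {X Y : FreeCat G ⥤ M} {f g : X ⟶ Y}
    (h : ∀ v : G.vertexSet, f.app (vertexObj v) = g.app (vertexObj v))
    (h' : ∀ e : G.edgeSet, f.app (edgeObj e) = g.app (edgeObj e)) : f = g := by
  ext x
  induction x using FreeCat.obj_cases with
  | vertex v => exact h v
  | edge e => exact h' e

end FreeCat

/-! ### Relative matching maps with respect to a set of arrows -/

section RelLift

variable {V E : Type w} {G : Graph V E} {M : Type u} [Category.{v} M]

/-- The right lifting property, with respect to a class `L`, of the relative matching map
`X^v ⟶ Y^v ×_{∏ Y^e} ∏ X^e` of `f : X ⟶ Y`, where the products are taken over the arrows `v ⟶ e`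
in `A v`. -/
def RelLift (L : MorphismProperty M) (A : ∀ v : G.vertexSet, Out v → Prop)
    {X Y : FreeCat G ⥤ M} (f : X ⟶ Y) (v : G.vertexSet) : Prop :=
  ∀ ⦃a b : M⦄ (i : a ⟶ b), L i → ∀ (s : a ⟶ X.obj (vertexObj v)) (t : b ⟶ Y.obj (vertexObj v))
    (c : ∀ x : Out v, A v x → (b ⟶ X.obj (edgeObj x.1))),
    i ≫ t = s ≫ f.app _ → (∀ x hx, i ≫ c x hx = s ≫ X.map x.2.hom) →
    (∀ x hx, c x hx ≫ f.app _ = t ≫ Y.map x.2.hom) →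
    ∃ l, i ≫ l = s ∧ l ≫ f.app _ = t ∧ ∀ x hx, l ≫ X.map x.2.hom = c x hx

/-- The right lifting property, with respect to a class `L`, of the map `X^v ⟶ ∏ X^e`, where the
product is taken over the arrows `v ⟶ e` in `A v`. -/
def ObjLift (L : MorphismProperty M) (A : ∀ v : G.vertexSet, Out v → Prop)
    (X : FreeCat G ⥤ M) (v : G.vertexSet) : Prop :=
  ∀ ⦃a b : M⦄ (i : a ⟶ b), L i → ∀ (s : a ⟶ X.obj (vertexObj v))
    (c : ∀ x : Out v, A v x → (b ⟶ X.obj (edgeObj x.1))),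
    (∀ x hx, i ≫ c x hx = s ≫ X.map x.2.hom) →
    ∃ l, i ≫ l = s ∧ ∀ x hx, l ≫ X.map x.2.hom = c x hx

theorem exists_lift_of_rlp {L : MorphismProperty M} {a b x y : M} {i : a ⟶ b} (hi : L i)
    {p : x ⟶ y} (hp : L.rlp p) (s : a ⟶ x) (t : b ⟶ y) (h : s ≫ p = i ≫ t) :
    ∃ l : b ⟶ x, i ≫ l = s ∧ l ≫ p = t := by
  have := hp i hi
  exact ⟨(CommSq.mk h).lift, CommSq.fac_left _, CommSq.fac_right _⟩

theorem rlp_of_exists_lift {L : MorphismProperty M} {x y : M} {p : x ⟶ y}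
    (h : ∀ ⦃a b : M⦄ (i : a ⟶ b), L i → ∀ (s : a ⟶ x) (t : b ⟶ y), s ≫ p = i ≫ t →
      ∃ l : b ⟶ x, i ≫ l = s ∧ l ≫ p = t) : L.rlp p := by
  intro a b i hi
  refine ⟨fun {s t} sq => ?_⟩
  obtain ⟨l, h₁, h₂⟩ := h i hi s t sq.w
  exact ⟨⟨⟨l, h₁, h₂⟩⟩⟩

section Products

variable [HasLimitsOfSize.{w, w} M]

theorem objLift_iff_rlp_lift (L : MorphismProperty M) (A : ∀ v : G.vertexSet, Out v → Prop)
    (X : FreeCat G ⥤ M) (v : G.vertexSet) :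
    ObjLift L A X v ↔ L.rlp (Pi.lift (fun x : { x : Out v // A v x } => X.map x.1.2.hom)) := by
  constructor
  · intro h
    refine rlp_of_exists_lift fun a b i hi s t hst => ?_
    obtain ⟨l, h₁, h₂⟩ := h i hi s (fun x hx => t ≫ Pi.π _ (⟨x, hx⟩ : { x : Out v // A v x }))
      (fun x hx => by rw [← Category.assoc, ← hst, Category.assoc, Pi.lift_π])
    refine ⟨l, h₁, Pi.hom_ext _ _ fun x => ?_⟩
    rw [Category.assoc, Pi.lift_π, h₂ x.1 x.2]
  · intro h a b i hi s c hc
    obtain ⟨l, h₁, h₂⟩ := exists_lift_of_rlp hi h s (Pi.lift fun x => c x.1 x.2)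
      (Pi.hom_ext _ _ fun x => by simp [hc x.1 x.2])
    refine ⟨l, h₁, fun x hx => ?_⟩
    have := h₂ =≫ Pi.π _ (⟨x, hx⟩ : { x : Out v // A v x })
    rwa [Category.assoc, Pi.lift_π, Pi.lift_π] at this

/-- The map `X^v ⟶ ∏ X^e`, where the product is taken over the arrows `v ⟶ e` in `A v`. -/
def prodMap (A : ∀ v : G.vertexSet, Out v → Prop) (X : FreeCat G ⥤ M) (v : G.vertexSet) :
    X.obj (vertexObj v) ⟶ ∏ᶜ fun x : { x : Out v // A v x } => X.obj (edgeObj x.1.1) :=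
  Pi.lift fun x => X.map x.1.2.hom

theorem prodMap_π (A : ∀ v : G.vertexSet, Out v → Prop) (X : FreeCat G ⥤ M) (v : G.vertexSet)
    (x : { x : Out v // A v x }) : prodMap A X v ≫ Pi.π _ x = X.map x.1.2.hom :=
  Pi.lift_π _ _

/-- The map `∏ X^e ⟶ ∏ Y^e` induced by `f : X ⟶ Y`, where the products are taken over the arrows
`v ⟶ e` in `A v`. -/
def prodTrans (A : ∀ v : G.vertexSet, Out v → Prop) {F F' : G.edgeSet → M} (f : ∀ e, F e ⟶ F' e)
    (v : G.vertexSet) :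
    (∏ᶜ fun x : { x : Out v // A v x } => F x.1.1) ⟶ ∏ᶜ fun x : { x : Out v // A v x } => F' x.1.1 :=
  Limits.Pi.map fun x => f x.1.1

theorem prodTrans_π (A : ∀ v : G.vertexSet, Out v → Prop) {F F' : G.edgeSet → M}
    (f : ∀ e, F e ⟶ F' e) (v : G.vertexSet) (x : { x : Out v // A v x }) :
    prodTrans A f v ≫ Pi.π _ x = Pi.π _ x ≫ f x.1.1 :=
  Pi.map_π _ _

theorem prodMap_comm (A : ∀ v : G.vertexSet, Out v → Prop) {X Y : FreeCat G ⥤ M} (f : X ⟶ Y)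
    (v : G.vertexSet) :
    f.app _ ≫ prodMap A Y v = prodMap A X v ≫ prodTrans A (fun e => f.app (edgeObj e)) v := by
  refine Pi.hom_ext _ _ fun x => ?_
  rw [Category.assoc, Category.assoc, prodMap_π, prodTrans_π, ← Category.assoc (prodMap A X v),
    prodMap_π, f.naturality]

variable [HasPullbacks M]

/-- The relative matching map `X^v ⟶ Y^v ×_{∏ Y^e} ∏ X^e` of `f : X ⟶ Y`, where the products are
taken over the arrows `v ⟶ e` in `A v`. -/
def relMap (A : ∀ v : G.vertexSet, Out v → Prop) {X Y : FreeCat G ⥤ M} (f : X ⟶ Y)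
    (v : G.vertexSet) :
    X.obj (vertexObj v) ⟶
      pullback (prodMap A Y v) (prodTrans A (fun e => f.app (edgeObj e)) v) :=
  pullback.lift (f.app _) (prodMap A X v) (prodMap_comm A f v)

theorem relMap_fst (A : ∀ v : G.vertexSet, Out v → Prop) {X Y : FreeCat G ⥤ M} (f : X ⟶ Y)
    (v : G.vertexSet) : relMap A f v ≫ pullback.fst _ _ = f.app _ :=
  pullback.lift_fst _ _ _

theorem relMap_snd (A : ∀ v : G.vertexSet, Out v → Prop) {X Y : FreeCat G ⥤ M} (f : X ⟶ Y)
    (v : G.vertexSet) : relMap A f v ≫ pullback.snd _ _ = prodMap A X v :=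
  pullback.lift_snd _ _ _

/-- This unpacks the universal properties of the pullback and the products. The elementwise form
`RelLift` makes it easy to change the set of arrows and to solve lifting problems one arrow at a
time. -/
theorem relLift_iff_rlp_relMap (L : MorphismProperty M) (A : ∀ v : G.vertexSet, Out v → Prop)
    {X Y : FreeCat G ⥤ M} (f : X ⟶ Y) (v : G.vertexSet) :
    RelLift L A f v ↔ L.rlp (relMap A f v) := by
  constructor
  · intro h
    refine rlp_of_exists_lift fun a b i hi s t hst => ?_
    have h₁ := hst =≫ pullback.fst _ _
    have h₂ := hst =≫ pullback.snd _ _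
    rw [Category.assoc, Category.assoc, relMap_fst] at h₁
    rw [Category.assoc, Category.assoc, relMap_snd] at h₂
    obtain ⟨l, h₃, h₄, h₅⟩ := h i hi s (t ≫ pullback.fst _ _)
      (fun x hx => t ≫ pullback.snd _ _ ≫ Pi.π _ (⟨x, hx⟩ : { x : Out v // A v x })) h₁.symm
      (fun x hx => by
        have := h₂ =≫ Pi.π _ (⟨x, hx⟩ : { x : Out v // A v x })
        rw [Category.assoc, prodMap_π, Category.assoc, Category.assoc] at this
        exact this.symm)
      (fun x hx => by
        have := (t ≫= pullback.condition (f := prodMap A Y v)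
          (g := prodTrans A (fun e => f.app (edgeObj e)) v)) =≫
            Pi.π _ (⟨x, hx⟩ : { x : Out v // A v x })
        simp only [Category.assoc, prodMap_π, prodTrans_π] at this ⊢
        exact this.symm)
    refine ⟨l, h₃, pullback.hom_ext (by rw [Category.assoc, relMap_fst, h₄])
      (Pi.hom_ext _ _ fun x => ?_)⟩
    simp only [Category.assoc]
    rw [← Category.assoc (relMap A f v), relMap_snd, prodMap_π, h₅ x.1 x.2]
  · intro h a b i hi s t c hst hs ht
    obtain ⟨l, h₁, h₂⟩ := exists_lift_of_rlp hi h s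
      (pullback.lift t (Pi.lift fun x => c x.1 x.2)
        (Pi.hom_ext _ _ fun x => by
          rw [Category.assoc, Category.assoc, prodMap_π, prodTrans_π, Pi.lift_π_assoc,
            ht x.1 x.2]))
      (pullback.hom_ext (by rw [Category.assoc, Category.assoc, relMap_fst, pullback.lift_fst, hst])
        (Pi.hom_ext _ _ fun x => by
          simp only [Category.assoc]
          rw [← Category.assoc (relMap A f v), relMap_snd, pullback.lift_snd_assoc, prodMap_π,
            Pi.lift_π, hs x.1 x.2]))
    have h₃ := h₂ =≫ pullback.fst _ _
    have h₄ := h₂ =≫ pullback.snd _ _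
    rw [Category.assoc, relMap_fst, pullback.lift_fst] at h₃
    rw [Category.assoc, relMap_snd, pullback.lift_snd] at h₄
    refine ⟨l, h₁, h₃, fun x hx => ?_⟩
    have := h₄ =≫ Pi.π _ (⟨x, hx⟩ : { x : Out v // A v x })
    rwa [Category.assoc, prodMap_π, Pi.lift_π] at this

/-- Factorization of a map of diagrams, first on the edges and then on the vertices. -/
theorem exists_diagram_factorization (L R : MorphismProperty M) [L.HasFactorization R]
    {X Y : FreeCat G ⥤ M} (f : X ⟶ Y) :
    ∃ (Z : FreeCat G ⥤ M) (i : X ⟶ Z) (p : Z ⟶ Y), i ≫ p = f ∧ L.functorCategory (FreeCat G) i ∧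
      (∀ e, R (p.app (edgeObj e))) ∧ ∀ v, R (relMap (fun _ _ => True) p v) := by
  let d (e : G.edgeSet) := L.factorizationData R (f.app (edgeObj e))
  let U : ∀ v : G.vertexSet, Out v → Prop := fun _ _ => True
  -- The target is the relative matching object of the intended `Z ⟶ Y`; it involves only the edge
  -- values of `Z`, which are already chosen.
  let g (v : G.vertexSet) : X.obj (vertexObj v) ⟶
      pullback (prodMap U Y v) (prodTrans U (fun e => (d e).p) v) :=
    pullback.lift (f.app _) (prodMap U X v ≫ prodTrans U (fun e => (d e).i) v)
      (Pi.hom_ext _ _ fun x => by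
        simp only [Category.assoc, prodMap_π, prodTrans_π]
        rw [← Category.assoc (prodTrans _ _ _), prodTrans_π, Category.assoc, (d x.1.1).fac,
          ← Category.assoc, prodMap_π, f.naturality])
  let d' (v : G.vertexSet) := L.factorizationData R (g v)
  let α (v : G.vertexSet) (x : Out v) : (d' v).Z ⟶ (d x.1).Z :=
    (d' v).p ≫ pullback.snd _ _ ≫ Pi.π _ (⟨x, trivial⟩ : { x : Out v // U v x })
  have hi (v : G.vertexSet) (x : Out v) : X.map x.2.hom ≫ (d x.1).i = (d' v).i ≫ α v x := by
    rw [(d' v).fac_assoc, pullback.lift_snd_assoc, Category.assoc, prodTrans_π, ← Category.assoc,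
      prodMap_π]
  have hp (v : G.vertexSet) (x : Out v) :
      α v x ≫ (d x.1).p = ((d' v).p ≫ pullback.fst _ _) ≫ Y.map x.2.hom := by
    have := pullback.condition (f := prodMap U Y v)
      (g := prodTrans U (fun e => (d e).p) v) =≫ Pi.π _ ⟨x, trivial⟩
    simp only [Category.assoc, prodMap_π, prodTrans_π] at this
    rw [Category.assoc, Category.assoc, Category.assoc, this]
  let Z : FreeCat G ⥤ M := mkDiagram (fun v => (d' v).Z) (fun e => (d e).Z) α
  have hZ (v : G.vertexSet) (x : Out v) : Z.map x.2.hom = α v x := mkDiagram_map_hom _ _ _ x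
  let i : X ⟶ Z := natTransMk (fun v => (d' v).i) (fun e => (d e).i) fun v x =>
    (hi v x).trans (congrArg (fun z => (d' v).i ≫ z) (hZ v x).symm)
  let p : Z ⟶ Y := natTransMk (fun v => (d' v).p ≫ pullback.fst _ _) (fun e => (d e).p) fun v x =>
    (congrArg (fun z => z ≫ (d x.1).p) (hZ v x)).trans (hp v x)
  refine ⟨Z, i, p, natTrans_ext (fun v => ?_) (fun e => (d e).fac), fun x => ?_,
    fun e => (d e).hp, fun v => ?_⟩
  · change (d' v).i ≫ (d' v).p ≫ pullback.fst _ _ = _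
    rw [(d' v).fac_assoc, pullback.lift_fst]
  · induction x using FreeCat.obj_cases with
    | vertex v => exact (d' v).hi
    | edge e => exact (d e).hi
  -- By construction the relative matching map of `p` is the right-hand factor of `g v`.
  · have : relMap U p v = (d' v).p := by
      refine pullback.hom_ext (relMap_fst U p v) ?_
      refine (relMap_snd U p v).trans (Pi.hom_ext _ _ fun x => ?_)
      exact ((prodMap_π U Z v x).trans (hZ v x.1)).trans (Category.assoc _ _ _).symm
    exact this ▸ (d' v).hp

end Products

/-- A map of diagrams whose edge components and relative matching maps have the right lifting
property with respect to `L` has it with respect to the maps that are objectwise in `L`. -/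
theorem rlp_functorCategory {L : MorphismProperty M} {X Y : FreeCat G ⥤ M} {f : X ⟶ Y}
    (h : ∀ e, L.rlp (f.app (edgeObj e))) (h' : ∀ v, RelLift L (fun _ _ => True) f v) :
    (L.functorCategory (FreeCat G)).rlp f := by
  refine rlp_of_exists_lift fun S T i hi s t hst => ?_
  have hst' (j) : s.app j ≫ f.app j = i.app j ≫ t.app j := by
    simpa using congr_app hst j
  choose l hl hl' using fun e => exists_lift_of_rlp (hi (edgeObj e)) (h e) (s.app _) (t.app _)
    (hst' _)
  choose k hk hk' hk'' using fun v => h' v (i.app _) (hi (vertexObj v)) (s.app _) (t.app _)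
    (fun x _ => T.map x.2.hom ≫ l x.1) (hst' _).symm
    (fun x _ => by rw [← i.naturality_assoc, hl, s.naturality])
    (fun x _ => by rw [Category.assoc, hl', t.naturality])
  exact ⟨natTransMk k l fun v x => (hk'' v x trivial).symm, natTrans_ext hk hl,
    natTrans_ext hk' hl'⟩

/-- A map of diagrams whose edge components and relative matching maps have the right lifting
property with respect to `L` has it objectwise. -/
theorem rlp_app {L : MorphismProperty M} {X Y : FreeCat G ⥤ M} {f : X ⟶ Y}
    {A : ∀ v : G.vertexSet, Out v → Prop}
    (h : ∀ e, L.rlp (f.app (edgeObj e))) (h' : ∀ v, RelLift L A f v) (j : FreeCat G) :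
    L.rlp (f.app j) := by
  induction j using FreeCat.obj_cases with
  | edge e => exact h e
  | vertex v =>
    refine rlp_of_exists_lift fun a b i hi s t hst => ?_
    choose c hc hc' using fun x : Out v => exists_lift_of_rlp hi (h x.1) (s ≫ X.map x.2.hom)
      (t ≫ Y.map x.2.hom) (by rw [Category.assoc, f.naturality, reassoc_of% hst])
    obtain ⟨l, h₁, h₂, -⟩ := h' v i hi s t (fun x _ => c x) hst.symm (fun x _ => hc x)
      (fun x _ => hc' x)
    exact ⟨l, h₁, h₂⟩

end RelLift

/-! ### The injective model structure on diagrams -/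

theorem functorCategory_hasTwoOutOfThreeProperty {C : Type*} [Category* C] {J : Type*}
    [Category* J] (W : MorphismProperty C) [W.HasTwoOutOfThreeProperty] :
    (W.functorCategory J).HasTwoOutOfThreeProperty where
  comp_mem _ _ hf hg j := W.comp_mem _ _ (hf j) (hg j)
  of_postcomp _ _ hg hfg j := W.of_postcomp _ _ (hg j) (hfg j)
  of_precomp _ _ hf hfg j := W.of_precomp _ _ (hf j) (hfg j)

section Injective

variable {V E : Type w} (G : Graph V E) (M : Type u) [Category.{v} M] [HasLimitsOfSize.{w, w} M]
  [ModelCategory M]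

/-- The objectwise cofibrations. -/
@[reducible]
def injectiveCofibrations : CategoryWithCofibrations (FreeCat G ⥤ M) where
  cofibrations := (cofibrations M).functorCategory _

/-- The objectwise weak equivalences. -/
@[reducible]
def injectiveWeakEquivalences : CategoryWithWeakEquivalences (FreeCat G ⥤ M) where
  weakEquivalences := (weakEquivalences M).functorCategory _

/-- The maps with the right lifting property with respect to the objectwise trivial
cofibrations. -/
@[reducible]
def injectiveFibrations : CategoryWithFibrations (FreeCat G ⥤ M) where
  fibrations := ((trivialCofibrations M).functorCategory _).rlp

attribute [local instance] injectiveCofibrations injectiveWeakEquivalences injectiveFibrations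

variable {G M}

theorem exists_trivialCofibration_factorization {X Y : FreeCat G ⥤ M} (f : X ⟶ Y) :
    ∃ (Z : FreeCat G ⥤ M) (i : X ⟶ Z) (p : Z ⟶ Y), i ≫ p = f ∧
      (trivialCofibrations M).functorCategory _ i ∧
      (∀ e, (trivialCofibrations M).rlp (p.app (edgeObj e))) ∧
      ∀ v, RelLift (trivialCofibrations M) (fun _ _ => True) p v := by
  obtain ⟨Z, i, p, fac, hi, h, h'⟩ :=
    exists_diagram_factorization (trivialCofibrations M) (fibrations M) f
  rw [← trivialCofibrations_rlp] at h h'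
  exact ⟨Z, i, p, fac, hi, h, fun v => (relLift_iff_rlp_relMap _ _ _ _).2 (h' v)⟩

theorem exists_cofibration_factorization {X Y : FreeCat G ⥤ M} (f : X ⟶ Y) :
    ∃ (Z : FreeCat G ⥤ M) (i : X ⟶ Z) (p : Z ⟶ Y), i ≫ p = f ∧
      cofibrations (FreeCat G ⥤ M) i ∧ weakEquivalences (FreeCat G ⥤ M) p ∧
      (cofibrations (FreeCat G ⥤ M)).rlp p := by
  obtain ⟨Z, i, p, fac, hi, h, h'⟩ :=
    exists_diagram_factorization (cofibrations M) (trivialFibrations M) f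
  rw [← cofibrations_rlp] at h h'
  have h'' (v) := (relLift_iff_rlp_relMap _ _ _ _).2 (h' v)
  refine ⟨Z, i, p, fac, hi, fun j => ?_, rlp_functorCategory h h''⟩
  have := rlp_app h h'' j
  rw [cofibrations_rlp] at this
  exact this.2

/-- The retract argument: the cofibration in a factorization of `f` is an objectwise weak
equivalence by two-out-of-three, so `f` lifts against it and is a retract of the other factor. -/
theorem rlp_of_trivialFibration {X Y : FreeCat G ⥤ M} {f : X ⟶ Y}
    (hf : trivialFibrations (FreeCat G ⥤ M) f) : (cofibrations (FreeCat G ⥤ M)).rlp f := by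
  obtain ⟨Z, i, p, fac, hi, hp, hp'⟩ := exists_cofibration_factorization f
  have hi' : weakEquivalences (FreeCat G ⥤ M) i := by
    have : weakEquivalences (FreeCat G ⥤ M) (i ≫ p) := fac ▸ hf.2
    exact fun j => (weakEquivalences M).of_postcomp _ _ (hp j) (this j)
  have : HasLiftingProperty i f := hf.1 i fun j => ⟨hi j, hi' j⟩
  exact MorphismProperty.of_retract (RetractArrow.ofRightLiftingProperty fac) hp'

variable (G M) in
/-- The model structure on diagrams in which the cofibrations and the weak equivalences are
objectwise. -/
@[reducible]
def injectiveModelCategory [HasColimitsOfSize.{w, w} M] : ModelCategory (FreeCat G ⥤ M) :=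
  have h₁ : (weakEquivalences (FreeCat G ⥤ M)).HasTwoOutOfThreeProperty :=
    functorCategory_hasTwoOutOfThreeProperty (weakEquivalences M)
  have h₂ : (weakEquivalences (FreeCat G ⥤ M)).IsStableUnderRetracts :=
    inferInstanceAs ((weakEquivalences M).functorCategory (FreeCat G)).IsStableUnderRetracts
  have h₃ : (cofibrations (FreeCat G ⥤ M)).IsStableUnderRetracts :=
    inferInstanceAs ((cofibrations M).functorCategory (FreeCat G)).IsStableUnderRetracts
  have h₄ : (fibrations (FreeCat G ⥤ M)).IsStableUnderRetracts :=
    inferInstanceAs ((trivialCofibrations M).functorCategory (FreeCat G)).rlp.IsStableUnderRetracts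
  have h₅ : (trivialCofibrations (FreeCat G ⥤ M)).HasFactorization (fibrations (FreeCat G ⥤ M)) :=
    ⟨fun f => by
      obtain ⟨Z, i, p, fac, hi, h, h'⟩ := exists_trivialCofibration_factorization f
      exact ⟨⟨Z, i, p, fac, ⟨fun j => (hi j).1, fun j => (hi j).2⟩, rlp_functorCategory h h'⟩⟩⟩
  have h₆ : (cofibrations (FreeCat G ⥤ M)).HasFactorization
      (trivialFibrations (FreeCat G ⥤ M)) :=
    ⟨fun f => by
      obtain ⟨Z, i, p, fac, hi, hp, hp'⟩ := exists_cofibration_factorization f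
      exact ⟨⟨Z, i, p, fac, hi, MorphismProperty.antitone_rlp (fun _ _ _ h j => (h j).1) _ hp',
        hp⟩⟩⟩
  { cm4a := fun i p _ _ hp => (show fibrations _ p from hp.mem) i fun j =>
      ⟨mem_cofibrations i j, mem_weakEquivalences i j⟩
    cm4b := fun i p hi _ _ => rlp_of_trivialFibration (mem_trivialFibrations p) i hi.mem }

/-- The limit functor sends maps with the right lifting property with respect to objectwise
cofibrations to weak equivalences. -/
theorem weakEquivalence_lim_map {X Y : FreeCat G ⥤ M} {f : X ⟶ Y}
    (hf : (cofibrations (FreeCat G ⥤ M)).rlp f) : weakEquivalences M (lim.map f) := by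
  -- The constant diagram on a cofibration is an objectwise cofibration; transpose along the
  -- adjunction between constant diagrams and limits.
  have : (cofibrations M).rlp (lim.map f) := fun a b i hi =>
    ((constLimAdj (J := FreeCat G) (C := M)).hasLiftingProperty_iff i f).1 (hf _ fun _ => hi)
  rw [cofibrations_rlp] at this
  exact this.2

variable [HasColimitsOfSize.{w, w} M]

attribute [local instance] injectiveModelCategory

/-- Ken Brown's lemma: `f` is a section of a trivial fibration followed by a trivial fibration, and
`lim` sends trivial fibrations to weak equivalences. -/
theorem weakEquivalence_lim_map_of_isFibrant {X Y : FreeCat G ⥤ M} [IsFibrant X] [IsFibrant Y]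
    (f : X ⟶ Y) [WeakEquivalence f] : weakEquivalences M (lim.map f) := by
  obtain ⟨h⟩ : Nonempty (FibrantBrownFactorization f) := inferInstance
  have hp : weakEquivalences M (lim.map h.p) :=
    weakEquivalence_lim_map (rlp_of_trivialFibration (mem_trivialFibrations _))
  have hr : weakEquivalences M (lim.map h.r) :=
    weakEquivalence_lim_map (rlp_of_trivialFibration (mem_trivialFibrations _))
  rw [← h.fac, lim.map_comp]
  refine MorphismProperty.comp_mem _ _ _ ?_ hp
  refine MorphismProperty.of_postcomp _ _ _ hr ?_
  rw [← lim.map_comp, h.i_r, lim.map_id, ← weakEquivalence_iff]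
  infer_instance

variable (G M) in
theorem derives_limHo :
    (FibrantObject.localizerMorphism (FreeCat G ⥤ M)).Derives (limHo (FreeCat G) M) := by
  intro X Y f hf
  have : WeakEquivalence f := ⟨hf⟩
  have : WeakEquivalence f.hom := inferInstance
  exact Localization.inverts (weakEquivalences M).Q (weakEquivalences M) _
    (weakEquivalence_lim_map_of_isFibrant f.hom)

variable (G M) in
theorem hasHolim : HasHolim (FreeCat G) M := by
  have : (limHo (FreeCat G) M).HasPointwiseRightDerivedFunctor
      (objectwiseWeakEquivalences (FreeCat G) M) :=
    (derives_limHo G M).hasPointwiseRightDerivedFunctor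
  exact Functor.hasRightDerivedFunctor_of_hasPointwiseRightDerivedFunctor _ _

/-- The canonical map `lim X ⟶ holim X` is an isomorphism if `X` is fibrant in the injective model
structure. -/
theorem isIso_limToHolim_of_isFibrant [HasHolim (FreeCat G) M] (X : FreeCat G ⥤ M)
    [IsFibrant X] : IsIso (limToHolim X) :=
  have : (objectwiseWeakEquivalences (FreeCat G) M).Q.IsLocalization
      (weakEquivalences (FreeCat G ⥤ M)) :=
    inferInstanceAs ((objectwiseWeakEquivalences (FreeCat G) M).Q.IsLocalization
      (objectwiseWeakEquivalences (FreeCat G) M))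
  have : ((limHo (FreeCat G) M).totalRightDerived (objectwiseWeakEquivalences (FreeCat G) M).Q
      (objectwiseWeakEquivalences (FreeCat G) M)).IsRightDerivedFunctor
        ((limHo (FreeCat G) M).totalRightDerivedUnit
          (objectwiseWeakEquivalences (FreeCat G) M).Q
          (objectwiseWeakEquivalences (FreeCat G) M)) (weakEquivalences (FreeCat G ⥤ M)) :=
    inferInstanceAs (Functor.IsRightDerivedFunctor _ _ (objectwiseWeakEquivalences (FreeCat G) M))
  (derives_limHo G M).isIso_of_isRightDerivedFunctor
    ((limHo (FreeCat G) M).totalRightDerivedUnit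
      (objectwiseWeakEquivalences (FreeCat G) M).Q
      (objectwiseWeakEquivalences (FreeCat G) M)) (FibrantObject.mk X)

/-- Any diagram admits an objectwise weak equivalence to a diagram `Y` which is fibrant in the
injective model structure; moreover all maps `Y^v ⟶ ∏ Y^e` are fibrations. -/
theorem exists_injective_resolution [HasHolim (FreeCat G) M] (X : FreeCat G ⥤ M) :
    ∃ (Y : FreeCat G ⥤ M) (i : X ⟶ Y), objectwiseWeakEquivalences (FreeCat G) M i ∧
      IsIso (limToHolim Y) ∧ (∀ e, IsFibrant (Y.obj (edgeObj e))) ∧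
      ∀ v, ObjLift (trivialCofibrations M) (fun _ _ => True) Y v := by
  obtain ⟨Y, i, p, -, hi, h, h'⟩ := exists_trivialCofibration_factorization
    (terminal.from X)
  have hT (j) : IsTerminal ((⊤_ (FreeCat G ⥤ M)).obj j) :=
    terminalIsTerminal.isTerminalObj ((evaluation _ _).obj j)
  have : IsFibrant Y := by
    rw [isFibrant_iff, Subsingleton.elim (terminal.from Y) p]
    exact ⟨rlp_functorCategory h h'⟩
  refine ⟨Y, i, fun j => (hi j).2, isIso_limToHolim_of_isFibrant Y, fun e => ?_, fun v => ?_⟩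
  · rw [isFibrant_iff_of_isTerminal _ (hT (edgeObj e)), fibration_iff, ← trivialCofibrations_rlp]
    exact h e
  · intro a b i hi s c hc
    obtain ⟨l, h₁, -, h₂⟩ := h' v i hi s ((hT _).from _) c ((hT _).hom_ext _ _) hc
      (fun _ _ => (hT _).hom_ext _ _)
    exact ⟨l, h₁, h₂⟩

end Injective

/-! ### Limits of diagrams which are fibrant with respect to an acyclic orientation -/

theorem exists_recursion {ι : Type*} (r : ι → ℕ) {β : ι → Type*}
    (Q : ∀ i, (∀ j, r j < r i → β j) → β i → Prop) (h : ∀ i f, ∃ b, Q i f b) :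
    ∃ F : ∀ i, β i, ∀ i, Q i (fun j _ => F j) (F i) := by
  choose g hg using h
  let F : ∀ i, β i := (measure r).wf.fix g
  refine ⟨F, fun i => ?_⟩
  have : F i = g i fun j _ => F j := WellFounded.fix_eq _ _ _
  rw [this]
  exact hg _ _

/-! ### Orientations of the simplification and arrows of the quiver -/

section Graphs

variable {V E : Type w} {G : Graph V E}

theorem mem_edgeSet_simplification {e : E} :
    e ∈ (simplification G).edgeSet ↔ e ∈ G.edgeSet ∧ ∀ v, ¬ G.IsLoopAt e v := by
  simp [simplification]

theorem isLink_of_simplification {e : E} {u v : V} (h : (simplification G).IsLink e u v) :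
    G.IsLink e u v ∧ u ≠ v := by
  have h' : G.IsLink e u v := h.1
  refine ⟨h', ?_⟩
  rintro rfl
  exact (mem_edgeSet_simplification.1 h.edge_mem).2 _ h'

namespace Orientation

variable (o : Orientation (simplification G))

theorem isLink' (e : (simplification G).edgeSet) :
    G.IsLink e (o.source e) (o.target e) :=
  (isLink_of_simplification (o.isLink e)).1

theorem source_ne_target (e : (simplification G).edgeSet) : o.source e ≠ o.target e :=
  (isLink_of_simplification (o.isLink e)).2

/-- The source of a non-loop edge as a vertex of `G`. -/
def src (e : G.edgeSet) (he : (e : E) ∈ (simplification G).edgeSet) : G.vertexSet :=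
  ⟨o.source ⟨e, he⟩, (o.isLink' ⟨e, he⟩).left_mem⟩

/-- The arrow of `Q(G)` from the source of a non-loop edge to the edge. -/
def srcHalfEdge (e : G.edgeSet) (he : (e : E) ∈ (simplification G).edgeSet) :
    HalfEdge G (o.src e he) e :=
  ⟨0, .inr ⟨⟨_, (o.source_ne_target ⟨e, he⟩).symm, o.isLink' ⟨e, he⟩⟩, rfl⟩⟩

/-- The set of arrows `A_o(v)`. -/
def arrows (v : G.vertexSet) (x : Out v) : Prop :=
  G.IsLoopAt x.1 v ∨ ∃ h : (x.1 : E) ∈ (simplification G).edgeSet, o.target ⟨x.1, h⟩ = v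

end Orientation

theorem HalfEdge.inc {v : G.vertexSet} {e : G.edgeSet} (x : HalfEdge G v e) : G.Inc e v :=
  x.2.elim (·.inc) (·.1.inc)

theorem HalfEdge.isLoopAt_or {v : G.vertexSet} {e : G.edgeSet} (x : HalfEdge G v e) :
    G.IsLoopAt e v ∨ (e : E) ∈ (simplification G).edgeSet := by
  obtain ⟨_, h | h⟩ := x
  · exact .inl h
  · exact .inr (mem_edgeSet_simplification.2 ⟨e.2, h.1.not_isLoopAt⟩)

theorem HalfEdge.eq_of_mem_simplification {v : G.vertexSet} {e : G.edgeSet}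
    (h : (e : E) ∈ (simplification G).edgeSet) (x y : HalfEdge G v e) : x = y := by
  have h' := (mem_edgeSet_simplification.1 h).2 v
  exact Subtype.ext (((x.2.resolve_left h').2).trans ((y.2.resolve_left h').2).symm)

/-- An arrow of `Q(G)` which is not in `A_o(v)` goes from the source of a non-loop edge to this
edge. -/
theorem Orientation.eq_src_of_not_arrows (o : Orientation (simplification G)) {v : G.vertexSet}
    {x : Out v} (hx : ¬ o.arrows v x) :
    ∃ h : (x.1 : E) ∈ (simplification G).edgeSet, v = o.src x.1 h := by
  have h := x.2.isLoopAt_or.resolve_left fun h => hx (.inl h)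
  refine ⟨h, Subtype.ext ((x.2.inc.eq_or_eq_of_isLink (o.isLink' ⟨x.1, h⟩)).resolve_right
    fun h' => hx (.inr ⟨h, h'.symm⟩))⟩

end Graphs

/-! ### Lifting problems for limits along an acyclic orientation -/

section Lim

variable {V E : Type w} {G : Graph V E} {M : Type u} [Category.{v} M] [HasLimitsOfSize.{w, w} M]

/-- Compatible families of maps to the values of a diagram at the vertices and edges correspond to
maps to the limit. -/
theorem exists_limit_lift (X : FreeCat G ⥤ M) {T : M} (f : ∀ v, T ⟶ X.obj (vertexObj v))
    (f' : ∀ e, T ⟶ X.obj (edgeObj e))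
    (h : ∀ (v : G.vertexSet) (x : Out v), f v ≫ X.map x.2.hom = f' x.1) :
    ∃ l : T ⟶ limit X, (∀ v, l ≫ limit.π X (vertexObj v) = f v) ∧
      ∀ e, l ≫ limit.π X (edgeObj e) = f' e := by
  let c : Cone X := ⟨T, natTransMk (X := (Functor.const _).obj T) f f' fun v x =>
    (Category.id_comp _).trans (h v x).symm⟩
  exact ⟨limit.lift X c, fun v => limit.lift_π c _, fun e => limit.lift_π c _⟩

theorem limit_hom_ext_diagram {X : FreeCat G ⥤ M} {T : M} {f g : T ⟶ limit X}
    (h : ∀ v : G.vertexSet, f ≫ limit.π X (vertexObj v) = g ≫ limit.π X (vertexObj v))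
    (h' : ∀ e : G.edgeSet, f ≫ limit.π X (edgeObj e) = g ≫ limit.π X (edgeObj e)) : f = g := by
  refine limit.hom_ext fun j => ?_
  induction j using FreeCat.obj_cases with
  | vertex v => exact h v
  | edge e => exact h' e

/-- If the edge components and the relative matching maps of `f` with respect to an acyclic
orientation have the right lifting property with respect to `L`, then so has the map on limits. -/
theorem rlp_lim_map (o : Orientation (simplification G)) {r : V → ℕ}
    (hr : ∀ e, r (o.source e) < r (o.target e)) {L : MorphismProperty M} {X Y : FreeCat G ⥤ M}
    {f : X ⟶ Y} (h : ∀ e, L.rlp (f.app (edgeObj e))) (h' : ∀ v, RelLift L o.arrows f v) :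
    L.rlp (lim.map f) := by
  refine rlp_of_exists_lift fun a b i hi s t hst => ?_
  have hst' (j) : (s ≫ limit.π X j) ≫ f.app j = i ≫ t ≫ limit.π Y j := by
    rw [← Category.assoc, ← hst, Category.assoc, Category.assoc]
    congr 1
    exact (limMap_π _ _).symm
  choose k hk hk' using fun e => exists_lift_of_rlp hi (h e) _ _ (hst' (edgeObj e))
  let β (v : G.vertexSet) : Type _ := { l : b ⟶ X.obj (vertexObj v) //
      i ≫ l = s ≫ limit.π X _ ∧ l ≫ f.app _ = t ≫ limit.π Y _ }
  classical
  -- On a non-loop edge the lift is dictated by the lift at the source; on a loop it is the freely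
  -- chosen `k e`.
  let m (e : G.edgeSet) (F : ∀ he, β (o.src e he)) : b ⟶ X.obj (edgeObj e) :=
    if he : (e : E) ∈ (simplification G).edgeSet then (F he).1 ≫ X.map (o.srcHalfEdge e he).hom
    else k e
  have hm (e F) : i ≫ m e F = s ≫ limit.π X _ ∧ m e F ≫ f.app _ = t ≫ limit.π Y _ := by
    dsimp only [m]
    split_ifs with he
    · constructor
      · rw [← Category.assoc, (F he).2.1, Category.assoc, limit.w]
      · rw [Category.assoc, f.naturality, ← Category.assoc, (F he).2.2, Category.assoc, limit.w]
    · exact ⟨hk _, hk' _⟩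
  have hlt {v : G.vertexSet} {x : Out v} (hx : o.arrows v x)
      (he : (x.1 : E) ∈ (simplification G).edgeSet) : r (o.src x.1 he) < r v := by
    obtain ⟨_, ht⟩ := hx.resolve_left ((mem_edgeSet_simplification.1 he).2 _)
    exact ht ▸ hr _
  -- When `v` is reached, the lifts on all edges of `A_o(v)` are known: non-loop edges there have
  -- sources of smaller rank. The relative lifting property at `v` extends them.
  obtain ⟨F, hF⟩ := exists_recursion (fun v : G.vertexSet => r v) (β := β)
    (fun v F l => ∀ (x : Out v) (hx : o.arrows v x),
      l.1 ≫ X.map x.2.hom = m x.1 fun he => F (o.src x.1 he) (hlt hx he))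
    (fun v F => by
      obtain ⟨l, h₁, h₂, h₃⟩ := h' v i hi _ _
        (fun x hx => m x.1 fun he => F (o.src x.1 he) (hlt hx he)) (hst' _).symm
        (fun x hx => by rw [(hm _ _).1, Category.assoc, limit.w])
        (fun x hx => by rw [(hm _ _).2, Category.assoc, limit.w])
      exact ⟨⟨l, h₁, h₂⟩, h₃⟩)
  obtain ⟨l, hl, hl'⟩ := exists_limit_lift X (fun v => (F v).1)
    (fun e => m e fun he => F (o.src e he)) fun v x => by
      by_cases hx : o.arrows v x
      · exact hF v x hx
      -- The remaining arrows start at the source of a non-loop edge, where compatibility holds by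
      -- the definition of `m`.
      · obtain ⟨he, hv⟩ := o.eq_src_of_not_arrows hx
        obtain ⟨e, x⟩ := x
        dsimp only at he hv
        subst hv
        dsimp only [m]
        rw [dif_pos he, HalfEdge.eq_of_mem_simplification he x (o.srcHalfEdge e he)]
  refine ⟨l, limit_hom_ext_diagram (fun v => ?_) (fun e => ?_),
    limit_hom_ext_diagram (fun v => ?_) (fun e => ?_)⟩
  · rw [Category.assoc, hl, (F v).2.1]
  · rw [Category.assoc, hl', (hm e _).1]
  · rw [Category.assoc, ← (F v).2.2, ← hl v, Category.assoc]
    congr 1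
    exact limMap_π _ _
  · rw [Category.assoc, ← (hm e fun he => F (o.src e he)).2, ← hl' e, Category.assoc]
    congr 1
    exact limMap_π _ _

end Lim

/-! ### Homotopy invariance of limits of orientation-fibrant diagrams -/

section Acyclic

variable {V E : Type w} {G : Graph V E} {M : Type u} [Category.{v} M]

theorem exists_lift_of_isFibrant [ModelCategory M] {a b x : M} [IsFibrant x] {i : a ⟶ b}
    (hi : trivialCofibrations M i) (s : a ⟶ x) : ∃ l : b ⟶ x, i ≫ l = s := by
  obtain ⟨l, h, -⟩ := exists_lift_of_rlp hi
    (by rw [trivialCofibrations_rlp]; exact mem_fibrations (terminal.from x)) s (terminal.from b)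
    (Subsingleton.elim _ _)
  exact ⟨l, h⟩

/-- Components along arrows outside the smaller set are not prescribed, but fibrancy of the edge
values lets them be extended over `b`. This is what allows `A_o(v)` and the `J⁻`-arrows at `v` to be
compared by inclusion alone. -/
theorem ObjLift.of_le [ModelCategory M] {X : FreeCat G ⥤ M} {A B : ∀ v : G.vertexSet, Out v → Prop}
    {v : G.vertexSet} (hX : ∀ e, IsFibrant (X.obj (edgeObj e)))
    (h : ObjLift (trivialCofibrations M) B X v) (hAB : ∀ x, A v x → B v x) :
    ObjLift (trivialCofibrations M) A X v := by
  classical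
  intro a b i hi s c hc
  choose d hd using fun x : Out v =>
    have := hX x.1
    exists_lift_of_isFibrant hi (s ≫ X.map x.2.hom)
  obtain ⟨l, h₁, h₂⟩ := h i hi s (fun x _ => if hx : A v x then c x hx else d x) fun x _ => by
    split_ifs with hx
    · exact hc x hx
    · exact hd x
  refine ⟨l, h₁, fun x hx => ?_⟩
  rw [h₂ x (hAB x hx), dif_pos hx]

section Projection

variable [ModelCategory M] {P B Z Z' : FreeCat G ⥤ M} {p : P ⟶ B} {q : B ⟶ Z} {q' : B ⟶ Z'}

theorem rlp_comp_of_isLimit {j : FreeCat G} (hB : IsLimit (BinaryFan.mk (q.app j) (q'.app j)))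
    (hp : (trivialCofibrations M).rlp (p.app j)) (hZ' : IsFibrant (Z'.obj j)) :
    (trivialCofibrations M).rlp ((p ≫ q).app j) := by
  refine rlp_of_exists_lift fun a b i hi s t hst => ?_
  rw [NatTrans.comp_app, ← Category.assoc] at hst
  obtain ⟨t', ht'⟩ := exists_lift_of_isFibrant hi (s ≫ p.app j ≫ q'.app j)
  obtain ⟨u, hu, hu'⟩ := BinaryFan.IsLimit.lift' hB t t'
  dsimp at hu hu'
  obtain ⟨l, h₁, h₂⟩ := exists_lift_of_rlp hi hp s u (BinaryFan.IsLimit.hom_ext hB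
    (by dsimp; rw [hst, Category.assoc, hu]) (by dsimp; simp only [Category.assoc, ← ht', hu']))
  exact ⟨l, h₁, by rw [NatTrans.comp_app, ← Category.assoc, h₂, hu]⟩

/-- Projecting away a factor `Z'` that is fibrant relative to `A` preserves relative fibrations. The
`Z'`-component of the lift is found first, with the prescribed edge values along `A`; then the
resulting map to `B` is lifted through `p`, after filling in the arrows outside `A` edge by edge. -/
theorem relLift_comp_of_isLimit {A : ∀ v : G.vertexSet, Out v → Prop} {v : G.vertexSet}
    (hB : ∀ j, IsLimit (BinaryFan.mk (q.app j) (q'.app j)))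
    (hp : ∀ e, (trivialCofibrations M).rlp (p.app (edgeObj e)))
    (hp' : RelLift (trivialCofibrations M) (fun _ _ => True) p v)
    (hZ' : ObjLift (trivialCofibrations M) A Z' v) :
    RelLift (trivialCofibrations M) A (p ≫ q) v := by
  classical
  intro a b i hi s t c hst hs hc
  simp only [NatTrans.comp_app] at hst hc
  obtain ⟨t', ht', hc'⟩ := hZ' i hi (s ≫ p.app _ ≫ q'.app _)
    (fun x hx => c x hx ≫ p.app _ ≫ q'.app _) fun x hx => by
      rw [← Category.assoc, hs x hx]
      simp only [Category.assoc, NatTrans.naturality, NatTrans.naturality_assoc]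
  obtain ⟨u, hu, hu'⟩ := BinaryFan.IsLimit.lift' (hB _) t t'
  dsimp at hu hu'
  have hsu : s ≫ p.app _ = i ≫ u := BinaryFan.IsLimit.hom_ext (hB _)
    (by dsimp; rw [Category.assoc, Category.assoc, hu, hst])
    (by dsimp; rw [Category.assoc, Category.assoc, hu', ht'])
  choose d hd hd' using fun x : Out v => exists_lift_of_rlp hi (hp x.1) (s ≫ P.map x.2.hom)
    (u ≫ B.map x.2.hom) (by rw [Category.assoc, p.naturality, reassoc_of% hsu])
  obtain ⟨l, h₁, h₂, h₃⟩ := hp' i hi s u (fun x _ => if hx : A v x then c x hx else d x)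
    hsu.symm
    (fun x _ => by
      split_ifs with hx
      · exact hs x hx
      · exact hd x)
    (fun x _ => by
      split_ifs with hx
      · refine BinaryFan.IsLimit.hom_ext (hB _) ?_ ?_
        · dsimp
          rw [Category.assoc, hc, Category.assoc, q.naturality, reassoc_of% hu]
        · dsimp
          rw [Category.assoc, ← hc', Category.assoc, q'.naturality, reassoc_of% hu']
      · exact hd' x)
  refine ⟨l, h₁, by rw [NatTrans.comp_app, ← Category.assoc, h₂, hu], fun x hx => ?_⟩
  rw [h₃ x trivial, dif_pos hx]

end Projection

variable [HasLimitsOfSize.{w, w} M] [ModelCategory M]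

/-- An objectwise weak equivalence whose edge components and relative matching maps are fibrations
has edge components and relative matching maps that are trivial fibrations. -/
theorem relLift_cofibrations_of_weakEquivalence {A : ∀ v : G.vertexSet, Out v → Prop}
    {X Y : FreeCat G ⥤ M} {f : X ⟶ Y}
    (hf : ∀ e, (trivialCofibrations M).rlp (f.app (edgeObj e)))
    (hf' : ∀ v, RelLift (trivialCofibrations M) A f v)
    (hw : objectwiseWeakEquivalences (FreeCat G) M f) :
    (∀ e, (cofibrations M).rlp (f.app (edgeObj e))) ∧
      ∀ v, RelLift (cofibrations M) A f v := by
  simp only [relLift_iff_rlp_relMap, trivialCofibrations_rlp, cofibrations_rlp] at hf hf' ⊢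
  have he (e) : Fibration (f.app (edgeObj e)) := ⟨hf e⟩
  have hwe (e : G.edgeSet) : WeakEquivalence (f.app (edgeObj e)) := ⟨hw _⟩
  refine ⟨fun e => ⟨hf e, hw _⟩, fun v => ⟨hf' v, ?_⟩⟩
  have h₁ : Fibration (prodTrans A (fun e => f.app (edgeObj e)) v) := by
    unfold prodTrans
    infer_instance
  have h₂ : WeakEquivalence (prodTrans A (fun e => f.app (edgeObj e)) v) := by
    unfold prodTrans
    infer_instance
  -- The projection to `Y^v` is a base change of a product of trivial fibrations, so
  -- two-out-of-three applies to `f.app = relMap ≫ fst`.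
  refine MorphismProperty.of_postcomp (weakEquivalences M) (relMap A f v) (pullback.fst _ _)
    (mem_weakEquivalences _) ?_
  rw [relMap_fst]
  exact hw _

variable (o : Orientation (simplification G)) {r : V → ℕ}

/-- The limit functor preserves weak equivalences between diagrams that are fibrant with respect to
an acyclic orientation. -/
theorem weakEquivalence_lim_map_of_objLift (hr : ∀ e, r (o.source e) < r (o.target e))
    {X Y : FreeCat G ⥤ M} (hX : ∀ e, IsFibrant (X.obj (edgeObj e)))
    (hX' : ∀ v, ObjLift (trivialCofibrations M) o.arrows X v)
    (hY : ∀ e, IsFibrant (Y.obj (edgeObj e)))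
    (hY' : ∀ v, ObjLift (trivialCofibrations M) o.arrows Y v)
    (f : X ⟶ Y) (hf : objectwiseWeakEquivalences (FreeCat G) M f) :
    weakEquivalences M (lim.map f) := by
  -- Factoring the graph of `f` gives `P` with projections to `Y` and `X`. Both are relative
  -- fibrations, since the factor projected away is orientation-fibrant, and both are weak
  -- equivalences.
  obtain ⟨P, i, p, fac, hi, hp, hp'⟩ := exists_trivialCofibration_factorization (prod.lift f (𝟙 X))
  have key {Z Z' : FreeCat G ⥤ M} (q : Y ⨯ X ⟶ Z) (q' : Y ⨯ X ⟶ Z')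
      (hB : ∀ j, Nonempty (IsLimit (BinaryFan.mk (q.app j) (q'.app j))))
      (hZ : ∀ e, IsFibrant (Z'.obj (edgeObj e)))
      (hZ' : ∀ v, ObjLift (trivialCofibrations M) o.arrows Z' v)
      (hw : objectwiseWeakEquivalences (FreeCat G) M (i ≫ p ≫ q)) :
      weakEquivalences M (lim.map (p ≫ q)) := by
    obtain ⟨h, h'⟩ := relLift_cofibrations_of_weakEquivalence (f := p ≫ q)
      (fun e => rlp_comp_of_isLimit (hB _).some (hp e) (hZ e))
      (fun v => relLift_comp_of_isLimit (fun j => (hB j).some) hp (hp' v) (hZ' v))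
      (fun j => MorphismProperty.of_precomp _ _ _ (hi j).2 (hw j))
    have := rlp_lim_map o hr h h'
    rw [cofibrations_rlp] at this
    exact this.2
  have hB (j) : IsLimit (BinaryFan.mk ((prod.fst : Y ⨯ X ⟶ Y).app j)
      ((prod.snd : Y ⨯ X ⟶ X).app j)) :=
    mapIsLimitOfPreservesOfIsLimit ((evaluation _ _).obj j) _ _ (prodIsProd Y X)
  have h₁ : i ≫ p ≫ prod.fst = f := by rw [← Category.assoc, fac, prod.lift_fst]
  have h₂ : i ≫ p ≫ prod.snd = 𝟙 X := by rw [← Category.assoc, fac, prod.lift_snd]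
  have hY := key prod.fst prod.snd (fun j => ⟨hB j⟩) hX hX' (h₁ ▸ hf)
  have hX := key prod.snd prod.fst (fun j => ⟨BinaryFan.isLimitFlip (hB j)⟩) ‹_› hY' (by
    rw [h₂]
    exact fun j => MorphismProperty.id_mem _ _)
  rw [← h₁, lim.map_comp]
  refine MorphismProperty.comp_mem _ _ _ ?_ hY
  refine MorphismProperty.of_postcomp _ _ _ hX ?_
  rw [← lim.map_comp, h₂, lim.map_id]
  exact MorphismProperty.id_mem _ _

variable [HasColimitsOfSize.{w, w} M]

/-- The canonical map `lim X ⟶ holim X` is an isomorphism if `X` is fibrant with respect to an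
acyclic orientation. -/
theorem isIso_limToHolim_of_objLift [HasHolim (FreeCat G) M]
    (hr : ∀ e, r (o.source e) < r (o.target e))
    {X : FreeCat G ⥤ M} (hX : ∀ e, IsFibrant (X.obj (edgeObj e)))
    (hX' : ∀ v, ObjLift (trivialCofibrations M) o.arrows X v) : IsIso (limToHolim X) := by
  obtain ⟨Y, f, hf, hY, hYe, hYv⟩ := exists_injective_resolution X
  have h₁ : IsIso ((limHo (FreeCat G) M).map f) :=
    Localization.inverts (weakEquivalences M).Q (weakEquivalences M) _
      (weakEquivalence_lim_map_of_objLift o hr hX hX' hYe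
        (fun v => (hYv v).of_le hYe fun _ _ => trivial) f hf)
  have h₂ : IsIso ((objectwiseWeakEquivalences (FreeCat G) M).Q.map f) :=
    Localization.inverts _ (objectwiseWeakEquivalences (FreeCat G) M) f hf
  have := ((limHo (FreeCat G) M).totalRightDerivedUnit
    (objectwiseWeakEquivalences (FreeCat G) M).Q
    (objectwiseWeakEquivalences (FreeCat G) M)).naturality f
  have h₃ : limToHolim X ≫ (holim (FreeCat G) M).map
      ((objectwiseWeakEquivalences (FreeCat G) M).Q.map f) =
      (limHo (FreeCat G) M).map f ≫ limToHolim Y := this.symm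
  have h₄ : IsIso (limToHolim X ≫ (holim (FreeCat G) M).map
      ((objectwiseWeakEquivalences (FreeCat G) M).Q.map f)) := h₃ ▸ inferInstance
  exact IsIso.of_isIso_comp_right _ ((holim (FreeCat G) M).map
    ((objectwiseWeakEquivalences (FreeCat G) M).Q.map f))

end Acyclic

/-! ### Reedy structures on the free category of a graphic quiver -/

section Reedy

variable {V E : Type w} {G : Graph V E} {M : Type u} [Category.{v} M]

theorem HalfEdge.not_identities_hom {v : G.vertexSet} {e : G.edgeSet} (x : HalfEdge G v e) :
    ¬ MorphismProperty.identities (FreeCat G) x.hom := by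
  suffices ∀ {y z : FreeCat G} (f : y ⟶ z), MorphismProperty.identities _ f → y = z from
    fun h => by cases this _ h
  rintro _ _ _ ⟨_⟩
  rfl

theorem FreeCat.identities_or_identities {x y z : FreeCat G} (f : x ⟶ y) (g : y ⟶ z) :
    MorphismProperty.identities _ f ∨ MorphismProperty.identities _ g := by
  induction f using FreeCat.hom_cases with
  | id => exact .inl (.mk _)
  | hom x => exact .inr (FreeCat.identities_of_source_edge g)

theorem FreeCat.eq_of_edge_hom {e e' : G.edgeSet} (f : edgeObj e ⟶ edgeObj e') :
    ∃ h : e = e', f = eqToHom (congrArg edgeObj h) := by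
  have := FreeCat.identities_of_source_edge f
  cases this
  exact ⟨rfl, rfl⟩

/-! ### Matching categories and Reedy fibrancy -/

namespace ReedyPair

section Matching

variable (R : ReedyPair (FreeCat G))

/-- The object of the matching category of a vertex `v` given by an arrow `v ⟶ e` in `J⁻`. -/
def mkMatching {v : G.vertexSet} (x : Out v) (hx : R.minus x.2.hom) :
    R.Matching (vertexObj v) :=
  ⟨MorphismProperty.Under.mk R.minus x.2.hom hx, x.2.not_identities_hom⟩

theorem exists_eq_mkMatching {v : G.vertexSet} (j : R.Matching (vertexObj v)) :
    ∃ x hx, j = R.mkMatching x hx := by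
  obtain ⟨⟨⟨⟨⟨⟩⟩, y, f⟩, hf⟩, hne⟩ := j
  cases y with
  | vertex v' => exact (hne (FreeCat.identities_of_target_vertex (v := v') f)).elim
  | edge e =>
    obtain ⟨x, rfl⟩ := FreeCat.hom_vertex_edge (e := e) f
    exact ⟨⟨e, x⟩, hf, rfl⟩

theorem mkMatching_injective {v : G.vertexSet} {x y : Out v} {hx : R.minus x.2.hom}
    {hy : R.minus y.2.hom} (h : R.mkMatching x hx = R.mkMatching y hy) : x = y := by
  obtain ⟨e, x⟩ := x
  obtain ⟨e', y⟩ := y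
  obtain rfl : e = e' := by
    have := congrArg (fun j => j.obj.right) h
    cases this
    rfl
  have h' := congrArg (fun j => (⟨j.obj.right, j.obj.hom⟩ : Σ z : FreeCat G, vertexObj v ⟶ z)) h
  exact congrArg (Sigma.mk e) (HalfEdge.hom_injective (eq_of_heq (Sigma.mk.inj h').2))

/-- The matching category of a vertex is discrete, because all morphisms out of an edge are
identities. Hence its limits are products over `J⁻`-arrows. -/
theorem eq_of_matching_hom {v : G.vertexSet} {j k : R.Matching (vertexObj v)} (φ : j ⟶ k) :
    ∃ h : j = k, (R.matchingForget _).map φ = eqToHom (congrArg (R.matchingForget _).obj h) := by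
  obtain ⟨⟨e, x⟩, hx, rfl⟩ := R.exists_eq_mkMatching j
  obtain ⟨⟨e', y⟩, hy, rfl⟩ := R.exists_eq_mkMatching k
  obtain ⟨rfl, h⟩ := FreeCat.eq_of_edge_hom (e := e) (e' := e') ((R.matchingForget _).map φ)
  have hw : x.hom ≫ (R.matchingForget (vertexObj v)).map φ = y.hom :=
    MorphismProperty.Under.w φ.hom
  rw [h] at hw
  obtain rfl : x = y := HalfEdge.hom_injective ((Category.comp_id _).symm.trans hw)
  exact ⟨rfl, h⟩

theorem isEmpty_matching_edge (e : G.edgeSet) : IsEmpty (R.Matching (edgeObj e)) :=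
  ⟨fun j => j.property (FreeCat.identities_of_source_edge j.obj.hom)⟩

variable [HasLimitsOfSize.{w, w} M] [ModelCategory M]

theorem fibration_matchingMap_vertex_iff (X : FreeCat G ⥤ M) (v : G.vertexSet) :
    Fibration (R.matchingMap X (vertexObj v)) ↔
      ObjLift (trivialCofibrations M) (fun _ x => R.minus x.2.hom) X v := by
  rw [fibration_iff, ← trivialCofibrations_rlp]
  constructor
  · intro h a b i hi s c hc
    -- The last clause records that the leg at `j` is the given `c x hx`, transported along the
    -- identification of `j` with the arrow `x`.
    have hd (j : R.Matching (vertexObj v)) : ∃ d : b ⟶ X.obj ((R.matchingForget _).obj j),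
        i ≫ d = s ≫ X.map (R.matchingHom j) ∧
        ∀ x hx (hj : R.mkMatching x hx = j), d = c x hx ≫
          X.map (eqToHom (congrArg (R.matchingForget _).obj hj)) := by
      obtain ⟨x, hx, rfl⟩ := R.exists_eq_mkMatching j
      refine ⟨c x hx, hc x hx, fun y hy hj => ?_⟩
      obtain rfl := R.mkMatching_injective hj
      exact ((congrArg (c y hy ≫ ·) (X.map_id _)).trans (Category.comp_id _)).symm
    choose d hd hd' using hd
    let C : Cone (R.matchingForget (vertexObj v) ⋙ X) :=
      { pt := b
        π := { app := d
               naturality := fun j k φ => by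
                obtain ⟨rfl, h⟩ := R.eq_of_matching_hom φ
                have h' : X.map ((R.matchingForget _).map φ) = 𝟙 _ :=
                  (congrArg X.map h).trans (X.map_id _)
                exact (Category.id_comp _).trans
                  ((congrArg (d j ≫ ·) h').trans (Category.comp_id _)).symm } }
    obtain ⟨l, h₁, h₂⟩ := exists_lift_of_rlp hi h s (limit.lift _ C) (limit.hom_ext fun j => by
      rw [Category.assoc, matchingMap_π, Category.assoc, limit.lift_π]
      exact (hd j).symm)
    refine ⟨l, h₁, fun x hx => ?_⟩
    have := h₂ =≫ limit.π _ (R.mkMatching x hx)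
    rw [Category.assoc, matchingMap_π, limit.lift_π] at this
    refine this.trans ((hd' _ x hx rfl).trans ?_)
    exact (congrArg (c x hx ≫ ·) (X.map_id _)).trans (Category.comp_id _)
  · intro h
    refine rlp_of_exists_lift fun a b i hi s t hst => ?_
    obtain ⟨l, h₁, h₂⟩ := h i hi s (fun x hx => t ≫ limit.π _ (R.mkMatching x hx)) fun x hx => by
      have := hst =≫ limit.π _ (R.mkMatching x hx)
      rw [Category.assoc, matchingMap_π, Category.assoc] at this
      exact this.symm
    refine ⟨l, h₁, limit.hom_ext fun j => ?_⟩
    obtain ⟨x, hx, rfl⟩ := R.exists_eq_mkMatching j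
    rw [Category.assoc, matchingMap_π]
    exact h₂ x hx

theorem fibration_matchingMap_edge (X : FreeCat G ⥤ M) (e : G.edgeSet)
    [IsFibrant (X.obj (edgeObj e))] : Fibration (R.matchingMap X (edgeObj e)) := by
  rw [fibration_iff, ← trivialCofibrations_rlp]
  have := R.isEmpty_matching_edge e
  refine rlp_of_exists_lift fun a b i hi s t hst => ?_
  obtain ⟨l, hl⟩ := exists_lift_of_isFibrant hi s
  exact ⟨l, hl, limit.hom_ext fun j => isEmptyElim j⟩

end Matching

section General

variable {J : Type w} [SmallCategory J] (R : ReedyPair J) [HasLimitsOfSize.{w, w} M]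

theorem isIso_matchingMap_of_isTerminal {Y : J ⥤ M} (hY : ∀ j, IsTerminal (Y.obj j)) (α : J) :
    IsIso (R.matchingMap Y α) :=
  ⟨(hY α).from _, (hY α).hom_ext _ _, limit.hom_ext fun _ => (hY _).hom_ext _ _⟩

/-- Over the terminal diagram the matching map of the base is an isomorphism, so the pullback in the
relative matching map is just the matching object of `X`. -/
theorem isReedyFibrant_iff [ModelCategory M] (X : J ⥤ M) :
    R.IsReedyFibrant X ↔ ∀ α, Fibration (R.matchingMap X α) := by
  have hT (j) : IsTerminal ((⊤_ (J ⥤ M)).obj j) :=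
    terminalIsTerminal.isTerminalObj ((evaluation _ _).obj j)
  have h (α : J) : Fibration (R.relMatchingMap (terminal.from X) α) ↔
      Fibration (R.matchingMap X α) := by
    have := R.isIso_matchingMap_of_isTerminal hT α
    have h' : R.relMatchingMap (terminal.from X) α ≫ pullback.snd _ _ = R.matchingMap X α :=
      pullback.lift_snd _ _ _
    rw [← h', fibration_iff, fibration_iff]
    exact ((fibrations M).cancel_right_of_respectsIso _ _).symm
  simp only [← h]
  exact ⟨fun h => h.mem, fun h => @Fibration.mk _ _ _ _ _ (R.reedyFibrations M) h⟩

end General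

theorem isReedyFibrant_freeCat_iff [HasLimitsOfSize.{w, w} M] [ModelCategory M]
    (R : ReedyPair (FreeCat G)) {X : FreeCat G ⥤ M} (hX : ∀ e, IsFibrant (X.obj (edgeObj e))) :
    R.IsReedyFibrant X ↔
      ∀ v, ObjLift (trivialCofibrations M) (fun _ x => R.minus x.2.hom) X v := by
  rw [isReedyFibrant_iff]
  simp only [← fibration_matchingMap_vertex_iff]
  refine ⟨fun h v => h _, fun h α => ?_⟩
  induction α using FreeCat.obj_cases with
  | vertex v => exact h v
  | edge e =>
    have := hX e
    exact R.fibration_matchingMap_edge X e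

end ReedyPair

end Reedy

/-! ### Degree functions and latching categories -/

namespace ReedyPair

section OfDegree

variable {J : Type w} [SmallCategory J]

theorem id_identities (x : J) : MorphismProperty.identities J (𝟙 x) := .mk _

/-- The morphisms which are identities or whose ends are strictly related by `r`. -/
def identitiesOr (r : J → J → Prop) : MorphismProperty J :=
  fun x y f => MorphismProperty.identities J f ∨ r x y

instance (r : J → J → Prop) [IsTrans J r] : (identitiesOr r).IsMultiplicative where
  id_mem x := .inl (id_identities x)
  comp_mem {x y z} f g hf hg := by
    rcases hf with ⟨⟨_⟩⟩ | hf
    · rwa [Category.id_comp]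
    · rcases hg with ⟨⟨_⟩⟩ | hg
      · rw [Category.comp_id]
        exact .inr hf
      · exact .inr (_root_.trans hf hg)

theorem nonempty_unique_factorization (deg : J → ℕ)
    (h : ∀ {x y z : J} (f : x ⟶ y) (g : y ⟶ z),
      MorphismProperty.identities J f ∨ MorphismProperty.identities J g)
    (hdeg : ∀ {x y : J} (f : x ⟶ y), ¬ MorphismProperty.identities J f → deg x ≠ deg y)
    {x y : J} (f : x ⟶ y) :
    Nonempty (Unique ((identitiesOr fun x y => deg y < deg x).MapFactorizationData
      (identitiesOr fun x y => deg x < deg y) f)) := by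
  by_cases hf : deg x < deg y
  · refine ⟨⟨⟨x, 𝟙 x, f, Category.id_comp _, .inl (id_identities x), .inr hf⟩⟩, ?_⟩
    rintro ⟨z, i, p, rfl, hi, hp⟩
    obtain ⟨⟨_⟩⟩ | hi := hi
    · congr 1
      exact (Category.id_comp _).symm
    · rcases hp with ⟨⟨_⟩⟩ | hp
      · omega
      · rcases h i p with ⟨⟨_⟩⟩ | ⟨⟨_⟩⟩ <;> omega
  · refine ⟨⟨⟨y, f, 𝟙 y, Category.comp_id _, ?_, .inl (id_identities y)⟩⟩, ?_⟩
    · by_cases hf' : MorphismProperty.identities J f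
      · exact .inl hf'
      · have := hdeg f hf'
        exact .inr (by omega)
    · rintro ⟨z, i, p, rfl, hi, hp⟩
      rcases hp with ⟨⟨_⟩⟩ | hp
      · congr 1
        exact (Category.comp_id _).symm
      · obtain ⟨⟨_⟩⟩ | hi := hi
        · omega
        · rcases h i p with ⟨⟨_⟩⟩ | ⟨⟨_⟩⟩ <;> omega

/-- The Reedy structure given by a degree function on a category without non-trivial
factorizations. -/
def ofDegree (deg : J → ℕ)
    (h : ∀ {x y z : J} (f : x ⟶ y) (g : y ⟶ z),
      MorphismProperty.identities J f ∨ MorphismProperty.identities J g)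
    (hdeg : ∀ {x y : J} (f : x ⟶ y), ¬ MorphismProperty.identities J f → deg x ≠ deg y) :
    ReedyPair J :=
  have : IsTrans J fun x y => deg y < deg x := ⟨fun _ _ _ h h' => h'.trans h⟩
  have : IsTrans J fun x y => deg x < deg y := ⟨fun _ _ _ h h' => h.trans h'⟩
  { minus := identitiesOr fun x y => deg y < deg x
    plus := identitiesOr fun x y => deg x < deg y
    minus_mul := inferInstance
    plus_mul := inferInstance
    exists_deg := ⟨{
      deg := deg
      lt₁ := fun _ hf hf' => hf.resolve_left hf'
      lt₂ := fun _ hf hf' => hf.resolve_left hf'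
      nonempty_unique := fun f => nonempty_unique_factorization deg h hdeg f }⟩ }

end OfDegree

variable {V E : Type w} {G : Graph V E}

section

variable (R : ReedyPair (FreeCat G))

/-- One factor of the Reedy factorization of an arrow must be an identity, so the arrow is the other
factor. -/
theorem plus_or_minus {v : G.vertexSet} {e : G.edgeSet} (x : HalfEdge G v e) :
    R.plus x.hom ∨ R.minus x.hom := by
  obtain ⟨S⟩ := R.exists_deg
  obtain ⟨Z, a, b, ha, hb, fac, -⟩ := S.exists_fac x.hom
  rcases FreeCat.identities_or_identities a b with ⟨⟨_⟩⟩ | ⟨⟨_⟩⟩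
  · rw [Category.id_comp] at fac
    exact .inl (fac ▸ hb)
  · rw [Category.comp_id] at fac
    exact .inr (fac ▸ ha)

/-- The object of the latching category of an edge `e` given by an arrow `v ⟶ e` in `J⁺`. -/
def mkLatching {v : G.vertexSet} {e : G.edgeSet} (x : HalfEdge G v e) (hx : R.plus x.hom) :
    R.Latching (edgeObj e) :=
  ⟨MorphismProperty.Over.mk R.plus x.hom hx, x.not_identities_hom⟩

theorem exists_eq_mkLatching {e : G.edgeSet} (j : R.Latching (edgeObj e)) :
    ∃ (v : G.vertexSet) (x : HalfEdge G v e) (hx : R.plus x.hom), j = R.mkLatching x hx := by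
  obtain ⟨⟨⟨y, ⟨⟨⟩⟩, f⟩, hf⟩, hne⟩ := j
  cases y with
  | edge e' => exact (hne (FreeCat.identities_of_source_edge (e := e') f)).elim
  | vertex v =>
    obtain ⟨x, rfl⟩ := FreeCat.hom_vertex_edge (v := v) f
    exact ⟨v, x, hf, rfl⟩

theorem isEmpty_latching_vertex (v : G.vertexSet) : IsEmpty (R.Latching (vertexObj v)) :=
  ⟨fun j => j.property (FreeCat.identities_of_target_vertex j.obj.hom)⟩

variable {R}

/-- If `R` has cofibrant constants, then there is at most one arrow in `J⁺` with a given target. -/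
theorem CofibrantConstants.eq (hR : R.CofibrantConstants) {e : G.edgeSet} {v v' : G.vertexSet}
    {x : HalfEdge G v e} {y : HalfEdge G v' e} (hx : R.plus x.hom) (hy : R.plus y.hom) :
    (⟨v, x⟩ : Σ v, HalfEdge G v e) = ⟨v', y⟩ := by
  have := hR (edgeObj e)
  -- Morphisms of the latching category lie over identities of vertices, so the underlying arrow is
  -- constant on connected components.
  have h := constant_of_preserves_morphisms
    (fun j : R.Latching (edgeObj e) => (⟨j.obj.left, j.obj.hom⟩ : Σ z : FreeCat G, z ⟶ edgeObj e))
    (fun j k φ => by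
      obtain ⟨v, x, hx, rfl⟩ := R.exists_eq_mkLatching j
      obtain ⟨v', x', hx', rfl⟩ := R.exists_eq_mkLatching k
      have hw : φ.hom.left ≫ x'.hom = x.hom := MorphismProperty.Over.w φ.hom
      have hφ := FreeCat.identities_of_target_vertex (v := v') φ.hom.left
      change (⟨vertexObj v, x.hom⟩ : Σ z : FreeCat G, z ⟶ edgeObj e) = ⟨vertexObj v', x'.hom⟩
      rw [← hw]
      generalize φ.hom.left = ψ at hφ
      change vertexObj v ⟶ vertexObj v' at ψ
      cases hφ
      exact congrArg _ (Category.id_comp _))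
    (R.mkLatching x hx) (R.mkLatching y hy)
  change (⟨vertexObj v, x.hom⟩ : Σ z : FreeCat G, z ⟶ edgeObj e) = ⟨vertexObj v', y.hom⟩ at h
  obtain ⟨h₁, h₂⟩ := Sigma.mk.inj h
  cases h₁
  exact congrArg (Sigma.mk v) (HalfEdge.hom_injective (eq_of_heq h₂))

theorem cofibrantConstants_of_subsingleton
    (h : ∀ (e : G.edgeSet) (v v' : G.vertexSet) (x : HalfEdge G v e) (y : HalfEdge G v' e),
      R.plus x.hom → R.plus y.hom → (⟨v, x⟩ : Σ v, HalfEdge G v e) = ⟨v', y⟩) :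
    R.CofibrantConstants := by
  intro α
  have : Subsingleton (R.Latching α) := by
    induction α using FreeCat.obj_cases with
    | vertex v =>
      have := R.isEmpty_latching_vertex v
      infer_instance
    | edge e =>
      refine ⟨fun j k => ?_⟩
      obtain ⟨v, x, hx, rfl⟩ := R.exists_eq_mkLatching j
      obtain ⟨v', y, hy, rfl⟩ := R.exists_eq_mkLatching k
      cases h e v v' x y hx hy
      rfl
  refine zigzag_isPreconnected fun j k => ?_
  rw [Subsingleton.elim j k]

end

end ReedyPair

/-! ### Cofibrant constants and acyclic orientations -/

section Orientation

variable {V E : Type w} {G : Graph V E}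

theorem Orientation.Acyclic.exists_rank {o : Orientation (simplification G)} (ho : o.Acyclic)
    (hV : G.vertexSet.Finite) : ∃ r : V → ℕ, ∀ e, r (o.source e) < r (o.target e) := by
  let rel : V → V → Prop := Relation.TransGen fun a b => ∃ e, o.source e = a ∧ o.target e = b
  -- The rank of `v` is the number of its strict predecessors; acyclicity makes the source of an
  -- edge a new predecessor of its target.
  refine ⟨fun v => { u ∈ G.vertexSet | rel u v }.ncard, fun e => ?_⟩
  have he : rel (o.source e) (o.target e) := .single ⟨e, rfl, rfl⟩
  refine Set.ncard_lt_ncard ⟨fun u hu => ⟨hu.1, hu.2.trans he⟩, fun h => ?_⟩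
    (hV.subset fun u hu => hu.1)
  exact ho _ (h ⟨(o.isLink' e).left_mem, he⟩).2

/-- A Reedy structure with cofibrant constants induces an acyclic orientation such that the arrows
in `A_o(v)` belong to `J⁻`. -/
theorem ReedyPair.CofibrantConstants.exists_orientation {R : ReedyPair (FreeCat G)}
    (hR : R.CofibrantConstants) : ∃ o : Orientation (simplification G), o.Acyclic ∧
      ∀ (v : G.vertexSet) (x : Out v), o.arrows v x → R.minus x.2.hom := by
  classical
  obtain ⟨S⟩ := R.exists_deg
  have hp {v : G.vertexSet} {e : G.edgeSet} {x : HalfEdge G v e} (hx : R.plus x.hom) :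
      S.deg (vertexObj v) < S.deg (edgeObj e) := S.lt₂ _ hx x.not_identities_hom
  have hm {v : G.vertexSet} {e : G.edgeSet} {x : HalfEdge G v e} (hx : R.minus x.hom) :
      S.deg (edgeObj e) < S.deg (vertexObj v) := S.lt₁ _ hx x.not_identities_hom
  let d (v : V) : ℕ := if hv : v ∈ G.vertexSet then S.deg (vertexObj ⟨v, hv⟩) else 0
  have hd (v : G.vertexSet) : d v = S.deg (vertexObj v) := dif_pos v.2
  let _ : LinearOrder V := linearOrderOfSTO WellOrderingRel
  -- Edges will point towards larger Reedy degree. Ends of equal degree are separated by an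
  -- auxiliary well-order of `V`, so every non-loop edge is oriented and the key strictly increases
  -- along it.
  let key (v : V) : ℕ ×ₗ V := toLex (d v, v)
  have hkey (e : (simplification G).edgeSet) : ∃ p : V × V,
      (simplification G).IsLink e p.1 p.2 ∧ key p.1 < key p.2 := by
    obtain ⟨u, v, h⟩ := Graph.exists_isLink_of_mem_edgeSet e.2
    have hne : key u ≠ key v := fun h' =>
      (isLink_of_simplification h).2 (congrArg (fun p => (ofLex p).2) h')
    rcases hne.lt_or_gt with h' | h'
    · exact ⟨(u, v), h, h'⟩
    · exact ⟨(v, u), h.symm, h'⟩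
  choose p hp₁ hp₂ using hkey
  let o : Orientation (simplification G) := ⟨fun e => (p e).1, fun e => (p e).2, hp₁⟩
  refine ⟨o, fun v hv => ?_, fun v x hx => ?_⟩
  · have (a b : V) (h : Relation.TransGen (fun a b => ∃ e, o.source e = a ∧ o.target e = b) a b) :
        key a < key b := by
      induction h with
      | single h =>
        obtain ⟨e, rfl, rfl⟩ := h
        exact hp₂ e
      | tail _ h ih =>
        obtain ⟨e, rfl, rfl⟩ := h
        exact ih.trans (hp₂ e)
    exact lt_irrefl _ (this v v hv)
  · refine (R.plus_or_minus x.2).resolve_left fun hplus => ?_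
    obtain ⟨e, x⟩ := x
    by_cases hl : G.IsLoopAt e v
    · have hy (y : HalfEdge G v e) : R.plus y.hom := (R.plus_or_minus y).resolve_right fun h =>
        lt_asymm (hm h) (hp hplus)
      have := hR.eq (hy ⟨0, .inl hl⟩) (hy ⟨1, .inl hl⟩)
      have := eq_of_heq (Sigma.mk.inj this).2
      have h₀ : (0 : Fin 2) = 1 := congrArg Subtype.val this
      exact absurd h₀ (by decide)
    · obtain ⟨he, ht⟩ := hx.resolve_left hl
      -- If the arrow from the source is also in `J⁺`, uniqueness identifies source and target. If
      -- it is in `J⁻`, the target has smaller degree than the source, against the choice of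
      -- orientation.
      rcases R.plus_or_minus (o.srcHalfEdge e he) with h | h
      · exact o.source_ne_target ⟨e, he⟩
          ((congrArg (fun z => (z.1 : V)) (hR.eq h hplus)).trans ht.symm)
      · have h₁ := (hp hplus).trans (hm h)
        rw [← hd, ← hd] at h₁
        have h₂ : key (o.source ⟨e, he⟩) < key (o.target ⟨e, he⟩) := hp₂ ⟨e, he⟩
        rw [ht, Prod.Lex.toLex_lt_toLex] at h₂
        change d v < d (o.source ⟨e, he⟩) at h₁
        rcases h₂ with h₂ | h₂
        · exact lt_asymm h₁ h₂
        · exact h₁.ne' h₂.1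

/-- An acyclic orientation induces a Reedy structure with cofibrant constants such that the arrows
in `J⁻` with source `v` are those in `A_o(v)`. -/
theorem Orientation.exists_reedyPair (o : Orientation (simplification G)) {r : V → ℕ}
    (hr : ∀ e, r (o.source e) < r (o.target e)) :
    ∃ R : ReedyPair (FreeCat G), R.CofibrantConstants ∧
      ∀ (v : G.vertexSet) (x : Out v), R.minus x.2.hom → o.arrows v x := by
  classical
  -- A non-loop edge lies just below its target and, as `2 * r s + 1 < 2 * r t` for `r s < r t`,
  -- above its source. Loops get degree `0`, below all vertices.
  let deg : FreeCat G → ℕ := fun x => match x with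
    | .vertex v => 2 * r v + 1
    | .edge e => if he : (e : E) ∈ (simplification G).edgeSet then 2 * r (o.target ⟨e, he⟩) else 0
  have hv (v : G.vertexSet) : deg (vertexObj v) = 2 * r v + 1 := rfl
  have he (e : G.edgeSet) (h : (e : E) ∈ (simplification G).edgeSet) :
      deg (edgeObj e) = 2 * r (o.target ⟨e, h⟩) := dif_pos h
  have he' (e : G.edgeSet) (h : (e : E) ∉ (simplification G).edgeSet) :
      deg (edgeObj e) = 0 := dif_neg h
  have hlt {v : G.vertexSet} (x : Out v) (hx : ¬ o.arrows v x) :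
      deg (vertexObj v) < deg (edgeObj x.1) := by
    obtain ⟨h, h'⟩ := o.eq_src_of_not_arrows hx
    have : r (o.src x.1 h) < r (o.target ⟨x.1, h⟩) := hr ⟨x.1, h⟩
    rw [← h'] at this
    rw [hv, he _ h]
    omega
  have hgt {v : G.vertexSet} (x : Out v) (hx : o.arrows v x) :
      deg (edgeObj x.1) < deg (vertexObj v) := by
    by_cases h : (x.1 : E) ∈ (simplification G).edgeSet
    · obtain ⟨_, ht⟩ := hx.resolve_left ((mem_edgeSet_simplification.1 h).2 _)
      rw [hv, he _ h, ht]
      omega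
    · rw [hv, he' _ h]
      omega
  refine ⟨.ofDegree deg FreeCat.identities_or_identities fun f hf => ?_,
    ReedyPair.cofibrantConstants_of_subsingleton fun e v v' x y hx hy => ?_, fun v x hx => ?_⟩
  · induction f using FreeCat.hom_cases with
    | id x => exact (hf (.mk _)).elim
    | @hom v e x =>
      by_cases hx : o.arrows v ⟨e, x⟩
      · exact (hgt _ hx).ne'
      · exact (hlt _ hx).ne
  · have hx' : ¬ o.arrows v ⟨e, x⟩ := fun h =>
      lt_asymm (hgt _ h) (hx.resolve_left x.not_identities_hom)
    have hy' : ¬ o.arrows v' ⟨e, y⟩ := fun h =>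
      lt_asymm (hgt _ h) (hy.resolve_left y.not_identities_hom)
    obtain ⟨h, hv⟩ := o.eq_src_of_not_arrows hx'
    obtain ⟨_, hv'⟩ := o.eq_src_of_not_arrows hy'
    obtain rfl : v = v' := hv.trans hv'.symm
    rw [HalfEdge.eq_of_mem_simplification h x y]
  · by_contra h
    exact lt_asymm (hlt _ h) (hx.resolve_left x.2.not_identities_hom)

end Orientation

/-! ### Fibrancy of all objects and the maps of condition 2 -/

section Fibrant

variable {M : Type u} [Category.{v} M] [HasLimitsOfSize.{w, w} M] [ModelCategory M]

/-- The projection from a one-factor product to the empty product is, up to isomorphism, the map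
from `x` to the terminal object. -/
theorem ProjectionsAreFibrations.isFibrant (hM : ProjectionsAreFibrations.{w} M) (x : M) :
    IsFibrant x := by
  have h := hM PUnit ∅ fun _ => x
  have hT : IsTerminal (∏ᶜ fun _ : (∅ : Set PUnit.{w + 1}) => x) :=
    IsTerminal.ofUniqueHom (fun _ => Pi.lift fun k => k.2.elim) fun _ _ =>
      Pi.hom_ext _ _ fun k => k.2.elim
  have h' : Fibration (Pi.lift (fun _ : PUnit.{w + 1} => 𝟙 x) ≫
      Pi.lift (fun k : (∅ : Set PUnit.{w + 1}) => Pi.π (fun _ => x) (k : PUnit))) := by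
    have : IsIso (Pi.lift (fun _ : PUnit.{w + 1} => 𝟙 x)) :=
      ⟨Pi.π (fun _ => x) PUnit.unit, Pi.lift_π _ _, Pi.hom_ext _ _ fun _ => by simp⟩
    infer_instance
  exact (isFibrant_iff_of_isTerminal _ hT).2 h'

theorem fibration_vertexMap_iff {V E : Type w} {G : Graph V E}
    (o : Orientation (simplification G)) (X : FreeCat G ⥤ M) (v : G.vertexSet) :
    Fibration (vertexMap o X v) ↔ ObjLift (trivialCofibrations M) o.arrows X v := by
  rw [objLift_iff_rlp_lift, trivialCofibrations_rlp, fibration_iff]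
  rfl

end Fibrant

end

end GraphicReedy
open GraphicReedy in
theorem mainTheorem4 {M : Type u} [Category.{v} M]
    [HasLimitsOfSize.{w, w} M] [HasColimitsOfSize.{w, w} M] [ModelCategory M]
    (hM : ProjectionsAreFibrations.{w} M)
    {V E : Type w} (G : Graph V E) (hV : G.vertexSet.Finite) (hE : G.edgeSet.Finite)
    (X : FreeCat G ⥤ M) :
    ((∃ R : ReedyPair (FreeCat G), R.CofibrantConstants ∧ R.IsReedyFibrant X) ↔
      ∃ o : Orientation (simplification G), o.Acyclic ∧
        ∀ v : G.vertexSet, Fibration (vertexMap o X v)) ∧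
    ∃ _ : HasHolim (FreeCat G) M,
      (∃ R : ReedyPair (FreeCat G), R.CofibrantConstants ∧ R.IsReedyFibrant X) →
        IsIso (limToHolim X) := by
  have hX (e) : IsFibrant (X.obj (edgeObj e)) := hM.isFibrant _
  have key : (∃ R : ReedyPair (FreeCat G), R.CofibrantConstants ∧ R.IsReedyFibrant X) ↔
      ∃ o : Orientation (simplification G), o.Acyclic ∧
        ∀ v : G.vertexSet, Fibration (vertexMap o X v) := by
    simp only [fibration_vertexMap_iff]
    constructor
    · rintro ⟨R, hR, hRX⟩
      obtain ⟨o, ho, hoR⟩ := hR.exists_orientation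
      rw [R.isReedyFibrant_freeCat_iff hX] at hRX
      exact ⟨o, ho, fun v => (hRX v).of_le hX (hoR v)⟩
    · rintro ⟨o, ho, hoX⟩
      obtain ⟨r, hr⟩ := ho.exists_rank hV
      obtain ⟨R, hR, hoR⟩ := o.exists_reedyPair hr
      exact ⟨R, hR, (R.isReedyFibrant_freeCat_iff hX).2 fun v => (hoX v).of_le hX (hoR v)⟩
  have hH : HasHolim (FreeCat G) M := hasHolim G M
  refine ⟨key, hH, fun h => ?_⟩
  obtain ⟨o, ho, hoX⟩ := key.1 h
  simp only [fibration_vertexMap_iff] at hoX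
  obtain ⟨r, hr⟩ := ho.exists_rank hV
  exact isIso_limToHolim_of_objLift o hr hX hoX
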